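/- **Conventions.** All graphs are finite and simple. A plane graph is *outerplane* if all its vertices lie on the outer face; the other faces are the *inner faces*; $E(s)$ is the set of edges on a face $s$, and $\partial s$ is the subgraph induced by $E(s)$. The *inner dual* of $G$ is the graph on the inner faces of $G$ in which two distinct faces are adjacent when they share an edge. The *resonance graph* $R(G)$ has the perfect matchings of $G$ as vertices; $M_1,M_2$ are adjacent if $M_1\oplus M_2=E(s)$ for an inner face $s$, called the *face-label* of the edge $M_1M_2$. Given a proper colouring of the vertices of $G$ with black and white, the *resonance digraph* $\overrightarrow R(G)$ is obtained by directing an edge $M_1M_2$ of $R(G)$ with face-label $s$ from $M_1$ to $M_2$ if every edge of $\partial s$ that belongs to $M_1$ goes from its white to its black end along the clockwise orientation of $\partial s$. A *reducible face decomposition* of $G$ with $n$ inner faces consists of subgraphs $G_1,\dots,G_n=G$, a sequence $s_1,\dots,s_n$ of all inner faces of $G$, and paths $P_2,\dots,P_n$ of odd length, such that $G_1=\partial s_1$ and, for $2\le i\le n$: $P_i$ joins two vertices of $G_{i-1}$ belonging to different bipartition sets of $G_{i-1}$, has no internal vertex in $G_{i-1}$, and lies in the exterior of $G_{i-1}$;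 $G_i=G_{i-1}+P_i$; and $P_i$ together with a part of the periphery (the boundary of the outer face) of $G_{i-1}$ surrounds the inner face $s_i$. **Theorem.** Let $G$ and $G'$ be 2-connected outerplane bipartite graphs, and let $\phi:R(G)\to R(G')$ be an isomorphism. Then there is a unique isomorphism $\widehat\phi$ from the inner dual of $G$ to the inner dual of $G'$ *induced by* $\phi$, i.e. such that, whenever an edge $MN$ of $R(G)$ has face-label $s$, the edge $\phi(M)\phi(N)$ of $R(G')$ has face-label $\widehat\phi(s)$. Moreover, with $n$ the number of inner faces of $G$, there are a reducible face decomposition of $G$ with face sequence $s_1,\dots,s_n$, graphs $G_1,\dots,G_n$ and odd length paths $P_2,\dots,P_n$, a reducible face decomposition of $G'$ with face sequence $s'_1,\dots,s'_n$, graphs $G'_1,\dots,G'_n$ and odd length paths $P'_2,\dots,P'_n$, and proper two-colourings (black and white) of $G$ and of $G'$ such that 1. $\widehat\phi(s_i)=s'_i$ for $1\le i\le n$; 2. for $2\le i\le n$, in clockwise orientation along the peripheries of $G_i$ and $G'_i$, the paths $P_i$ and $P'_i$ either both start from a black vertex and end with a white vertex, or both start from a white vertex and end with a black vertex; 3. $\phi$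 is an isomorphism between the resonance digraphs $\overrightarrow R(G)$ and $\overrightarrow R(G')$ with respect to these colourings. -/

import Mathlib

/-- A graph is 2-connected if it has at least three vertices, is connected, and stays connected
after the deletion of any single vertex. -/
def SimpleGraph.IsTwoConnected {V : Type*} (G : SimpleGraph V) : Prop :=
  3 ≤ Nat.card V ∧ G.Connected ∧ ∀ v : V, (G.induce {v}ᶜ).Connected

/-- For a rotation of the darts of `G` (at each vertex, the cyclic order of the outgoing darts),
the permutation which sends a dart `u → v` to the dart that follows `v → u` around `v`. -/
def SimpleGraph.faceNext {V : Type*} {G : SimpleGraph V} (rot : Equiv.Perm G.Dart) :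
    Equiv.Perm G.Dart :=
  (Function.Involutive.toPerm _ (SimpleGraph.Dart.symm_involutive (G := G))).trans rot

/-- A connected plane graph, given combinatorially: a rotation system of genus zero on a connected
graph, together with the choice of the outer face.

`rot d` is the dart that follows `d` in counterclockwise order among the darts with the same tail.
The faces are the orbits of `faceNext rot`; walking along such an orbit, the face is always on the
right hand side, so that every inner face is traversed in clockwise direction.  Euler's formula
says that the surface obtained by gluing a disc to every face is a sphere. -/
structure PlaneEmbedding {V : Type*} (G : SimpleGraph V) where
  rot : Equiv.Perm G.Dart
  rot_fst : ∀ d, (rot d).fst = d.fst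
  rot_sameCycle : ∀ d d' : G.Dart, d.fst = d'.fst → rot.SameCycle d d'
  connected : G.Connected
  euler : Nat.card V + Nat.card (Quotient (Equiv.Perm.SameCycle.setoid (G.faceNext rot)))
    = Nat.card G.edgeSet + 2
  outer : Quotient (Equiv.Perm.SameCycle.setoid (G.faceNext rot))

namespace PlaneEmbedding

variable {V : Type*} {G : SimpleGraph V} (P : PlaneEmbedding G)

/-- The clockwise successor of a dart on the boundary of the face to its right. -/
def next : Equiv.Perm G.Dart := G.faceNext P.rot

/-- The faces of the plane graph. -/
def Face : Type _ := Quotient (Equiv.Perm.SameCycle.setoid P.next)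

/-- The outer (infinite) face. -/
def outerFace : P.Face := P.outer

/-- The face to the right of a dart. -/
def faceOf (d : G.Dart) : P.Face := Quotient.mk (Equiv.Perm.SameCycle.setoid P.next) d

/-- The inner (finite) faces. -/
def InnerFace : Type _ := {s : P.Face // s ≠ P.outerFace}

/-- The set `E(s)` of the edges lying on the face `s`. -/
def faceEdges (s : P.Face) : Set (Sym2 V) := {e | ∃ d : G.Dart, P.faceOf d = s ∧ d.edge = e}

/-- The periphery `∂s` of the face `s`: the subgraph induced by the edges in `E(s)`. -/
def periphery (s : P.Face) : G.Subgraph where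
  verts := {v | ∃ e ∈ P.faceEdges s, v ∈ e}
  Adj u v := s(u, v) ∈ P.faceEdges s
  adj_sub := by
    rintro u v ⟨d, -, hd⟩
    have h := d.edge_mem
    rwa [hd, SimpleGraph.mem_edgeSet] at h
  edge_vert := by
    intro u v h
    exact ⟨s(u, v), h, Sym2.mem_mk_left u v⟩
  symm := ⟨by
    intro u v h
    rwa [Sym2.eq_swap]⟩

/-- The plane graph is outerplane: every vertex belongs to the outer face. -/
def IsOuterplane : Prop := ∀ v : V, v ∈ (P.periphery P.outerFace).verts

/-- The inner dual: its vertices are the inner faces, two of them being adjacent if they have an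
edge in common. -/
def innerDual : SimpleGraph P.InnerFace where
  Adj s t := s ≠ t ∧ (P.faceEdges s.1 ∩ P.faceEdges t.1).Nonempty
  symm := ⟨by
    rintro s t ⟨h, e, hs, ht⟩
    exact ⟨h.symm, e, ht, hs⟩⟩
  loopless := ⟨fun _ h => h.1 rfl⟩

theorem faceEdges_nonempty (s : P.Face) : (P.faceEdges s).Nonempty := by
  induction s using Quotient.inductionOn with
  | h d => exact ⟨d.edge, d, rfl, rfl⟩

end PlaneEmbedding

/-- The type of perfect matchings of `G`. -/
def SimpleGraph.PerfectMatching {V : Type*} (G : SimpleGraph V) : Type _ :=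
  {M : G.Subgraph // M.IsPerfectMatching}

/-- The edge set of a perfect matching. -/
def SimpleGraph.PerfectMatching.edges {V : Type*} {G : SimpleGraph V} (M : G.PerfectMatching) :
    Set (Sym2 V) := M.1.edgeSet

namespace PlaneEmbedding

variable {V : Type*} {G : SimpleGraph V} (P : PlaneEmbedding G)

/-- `M ⊕ N = E(s)`: in the resonance graph, `MN` is an edge with face-label `s`. -/
def HasLabel (M N : G.PerfectMatching) (s : P.InnerFace) : Prop :=
  symmDiff M.edges N.edges = P.faceEdges s.1

/-- The resonance graph `R(G)`: two perfect matchings are adjacent if their symmetric difference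
is the edge set of an inner face. -/
def resonanceGraph : SimpleGraph G.PerfectMatching where
  Adj M N := ∃ s : P.InnerFace, P.HasLabel M N s
  symm := ⟨by
    rintro M N ⟨s, h⟩
    exact ⟨s, by rw [HasLabel, symmDiff_comm]; exact h⟩⟩
  loopless := ⟨by
    rintro M ⟨s, h⟩
    have hne := P.faceEdges_nonempty s.1
    rw [HasLabel, symmDiff_self] at h
    rw [← h] at hne
    exact Set.not_nonempty_empty hne⟩

/-- The face `s` is `M`-resonant: along its boundary the edges are alternately in `M` and
not in `M`. -/
def IsResonant (M : G.PerfectMatching) (s : P.InnerFace) : Prop :=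
  ∀ d : G.Dart, P.faceOf d = s.1 → (d.edge ∈ M.edges ↔ (P.next d).edge ∉ M.edges)

end PlaneEmbedding

/-- The two colours of a proper two-colouring. -/
abbrev Colour : Type := Bool

/-- The colour white. -/
abbrev Colour.white : Colour := true

/-- The colour black. -/
abbrev Colour.black : Colour := false

namespace PlaneEmbedding

variable {V : Type*} {G : SimpleGraph V} (P : PlaneEmbedding G)

/-- The boundary of the inner face `s` is a proper `M`-alternating cycle: it is `M`-alternating,
and each of its edges belonging to `M` goes from a white to a black vertex along the clockwise
orientation. -/
def IsProper (c : G.Coloring Colour) (M : G.PerfectMatching) (s : P.InnerFace) : Prop :=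
  P.IsResonant M s ∧ ∀ d : G.Dart, P.faceOf d = s.1 → d.edge ∈ M.edges →
    c d.fst = Colour.white ∧ c d.snd = Colour.black

/-- The resonance digraph with respect to the colouring `c`: there is an arc from `M` to `N` if
`M ⊕ N` is a proper `M`-alternating cycle surrounding an inner face. -/
def resonanceDigraph (c : G.Coloring Colour) : Digraph G.PerfectMatching where
  Adj M N := ∃ s : P.InnerFace, P.HasLabel M N s ∧ P.IsProper c M s

/-- A face of `G` lies in the exterior of the subgraph `H` (that is, it is contained in the
outer face of `H`) if it can be reached from the outer face of `G` by crossing only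
edges that are not in `H`. -/
def InExterior (H : G.Subgraph) (s : P.Face) : Prop :=
  Relation.ReflTransGen
    (fun f g => ∃ d : G.Dart, d.edge ∉ H.edgeSet ∧ P.faceOf d = f ∧ P.faceOf d.symm = g)
    P.outerFace s

/-- An edge of `G` lies in the exterior of `H` if it is not an edge of `H` and the faces on both
its sides lie in the exterior of `H`. -/
def EdgeInExterior (H : G.Subgraph) (e : Sym2 V) : Prop :=
  e ∉ H.edgeSet ∧ ∀ d : G.Dart, d.edge = e → P.InExterior H (P.faceOf d)

/-- The edges of the periphery of `H`, i.e. those edges of `H` which lie on its outer face. -/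
def outerEdges (H : G.Subgraph) : Set (Sym2 V) :=
  {e | e ∈ H.edgeSet ∧ ∃ d : G.Dart, d.edge = e ∧ P.InExterior H (P.faceOf d)}

/-- The walk `p` runs along the periphery of `H` in clockwise orientation: each of its
edges belongs to `H`, and has the exterior of `H` on its left and not on its right. -/
def IsClockwise (H : G.Subgraph) {u v : V} (p : G.Walk u v) : Prop :=
  ∀ d ∈ p.darts, d.edge ∈ H.edgeSet ∧ P.InExterior H (P.faceOf d.symm) ∧
    ¬ P.InExterior H (P.faceOf d)

/-- A reducible face decomposition `RFD(G₁, …, Gₙ)` of a plane bipartite graph `G` with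
`n = m + 1` inner faces, associated with the face sequence `s₁, …, sₙ` and the sequence
`P₂, …, Pₙ` of odd length ears.  Indices are shifted: `graph i` and `face i` with `i : Fin (m + 1)`
stand for `G_{i+1}` and `s_{i+1}`, and `ear i` with `i : Fin m` stands for `P_{i+2}`, which
is added to `graph i.castSucc` to form `graph i.succ`. -/
structure ReducibleFaceDecomposition (m : ℕ) where
  graph : Fin (m + 1) → G.Subgraph
  face : Fin (m + 1) → P.InnerFace
  start : Fin m → V
  finish : Fin m → V
  ear : ∀ i : Fin m, G.Walk (start i) (finish i)
  /-- The faces `s₁, …, sₙ` are the inner faces of `G`, each listed once. -/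
  face_bijective : Function.Bijective face
  /-- `G₁` is the periphery of the inner face `s₁`. -/
  graph_zero : graph 0 = P.periphery (face 0).1
  /-- `Gₙ = G`. -/
  graph_last : graph (Fin.last m) = ⊤
  ear_isPath : ∀ i, (ear i).IsPath
  ear_odd : ∀ i, Odd (ear i).length
  start_mem : ∀ i, start i ∈ (graph i.castSucc).verts
  finish_mem : ∀ i, finish i ∈ (graph i.castSucc).verts
  /-- The ends of the ear belong to different bipartition sets of the previous graph. -/
  ends_colour : ∀ i, ∀ c : (graph i.castSucc).coe.Coloring Colour,
    c ⟨start i, start_mem i⟩ ≠ c ⟨finish i, finish_mem i⟩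
  /-- No internal vertex of the ear belongs to the previous graph. -/
  ear_internal : ∀ i, ∀ v ∈ (ear i).support, v ∈ (graph i.castSucc).verts →
    v = start i ∨ v = finish i
  graph_succ : ∀ i : Fin m, graph i.succ = graph i.castSucc ⊔ (ear i).toSubgraph
  /-- The ear lies in the exterior of the previous graph. -/
  ear_exterior : ∀ i, ∀ e ∈ (ear i).edges, P.EdgeInExterior (graph i.castSucc) e
  /-- The ear and a part of the periphery of the previous graph surround the inner face. -/
  ear_surround : ∀ i : Fin m, ∃ Q ⊆ P.outerEdges (graph i.castSucc),
    P.faceEdges (face i.succ).1 = {e | e ∈ (ear i).edges} ∪ Q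

/-- In clockwise orientation along the periphery of the graph which it completes, the ear with
index `i` starts from a vertex of colour `x` and ends with a vertex of colour `y`. -/
def ReducibleFaceDecomposition.EarRuns {P : PlaneEmbedding G} {m : ℕ}
    (D : P.ReducibleFaceDecomposition m) (c : G.Coloring Colour) (i : Fin m) (x y : Colour) :
    Prop :=
  (P.IsClockwise (D.graph i.succ) (D.ear i) ∧ c (D.start i) = x ∧ c (D.finish i) = y) ∨
  (P.IsClockwise (D.graph i.succ) (D.ear i).reverse ∧ c (D.finish i) = x ∧ c (D.start i) = y)

/-- The isomorphism `ψ` of inner duals is induced by the isomorphism `φ` of resonance graphs: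
whenever an edge `MN` of `R(G)` has face-label `s`, the edge `φ(M)φ(N)` of `R(G')` has
face-label `ψ(s)`. -/
def IsInducedBy {P : PlaneEmbedding G} {V' : Type*} {G' : SimpleGraph V'}
    {P' : PlaneEmbedding G'} (φ : P.resonanceGraph ≃g P'.resonanceGraph)
    (ψ : P.innerDual ≃g P'.innerDual) : Prop :=
  ∀ (M N : G.PerfectMatching) (s : P.InnerFace),
    P.HasLabel M N s → P'.HasLabel (φ M) (φ N) (ψ s)

end PlaneEmbedding

/-!
The resonance graph of a 2-connected outerplane bipartite graph is the graph of the closed sets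
(lower sets) of an oriented tree, and such a graph determines the tree, and its orientation up to
reversal.

*Plane topology.*  A plane graph is given as a rotation system of genus zero, and the only global
input is a form of the Jordan curve theorem modulo two (`exists_face_potential`): Euler's formula
says that every even set of edges is the border of a set of faces.  In a 2-connected graph it
follows that no face meets a vertex twice (`dart_ext`), and in an outerplane one that each chord
separates the inner faces (`exists_separation`); the inner dual is a connected graph all of whose
edges are bridges.

*Perfect matchings.*  Fix a proper colouring and orient each edge of the inner dual from the face on
the right of the chord, directed from white to black, to the face on its left (`DualArc`).  Turning
around a vertex, starting from the outer face, one sees that the perfect matchings correspond to the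
sets `S` of inner faces which contain with the head of an arc also its tail: the matching consists
of the edges which, from white to black, have `S` on the right and not on the left
(`exists_encoding`).  Two matchings are adjacent with label `s` if and only if their sets differ in
`s` only, and the edge of the resonance digraph leads to the smaller set (`hasLabel_iff`,
`isProper_iff`).

*Isomorphisms.*  In the graph of closed sets, the steps which add a fixed element are connected
through squares, so an isomorphism `φ` maps them to steps which add or remove a fixed element `ψ s`
(`IsOrientedTree.exists_label`).  Hence `φ S` is `ψ '' S` up to symmetric difference with the fixed
set `φ ∅`.  Since the image contains the empty set and the whole tree, the two ends of an arc both
correspond to elements of `φ ∅` or both do not, so that `φ ∅` is empty or everything, and `ψ`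
preserves all arcs or reverses all of them
(`IsOrientedTree.exists_equiv_of_closedSetIso`).  In the latter case the two colours of the second
graph are exchanged.

*Decompositions.*  Any listing of the inner faces in which each face is adjacent to an earlier one
gives a reducible face decomposition, whose ears are the face boundaries without the chord to the
earlier face (`exists_reducibleFaceDecomposition`).  Such a listing of the faces of the first graph
is carried over by `ψ`, and the colour in which an ear starts is determined by the direction of the
arc at this chord, which `ψ` preserves.
-/

/-! ### Darts, faces and rotations -/

namespace PlaneEmbedding

variable {V : Type*} {G : SimpleGraph V} (P : PlaneEmbedding G)

theorem next_fst (d : G.Dart) : (P.next d).fst = d.snd :=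
  P.rot_fst d.symm

theorem faceOf_next (d : G.Dart) : P.faceOf (P.next d) = P.faceOf d :=
  Quotient.sound (Equiv.Perm.sameCycle_apply_left.2 (Equiv.Perm.SameCycle.refl _ _))

theorem faceOf_rot (d : G.Dart) : P.faceOf (P.rot d) = P.faceOf d.symm := by
  rw [← P.faceOf_next d.symm]
  rfl

theorem faceOf_eq_iff {d d' : G.Dart} : P.faceOf d = P.faceOf d' ↔ P.next.SameCycle d d' :=
  Quotient.eq (r := Equiv.Perm.SameCycle.setoid P.next)

theorem exists_faceOf_eq (f : P.Face) : ∃ d, P.faceOf d = f := by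
  induction f using Quotient.inductionOn with
  | h d => exact ⟨d, rfl⟩

instance [Finite V] : Finite P.Face :=
  have : Finite G.Dart := Finite.of_injective _ SimpleGraph.Dart.toProd_injective
  Finite.of_surjective _ P.exists_faceOf_eq

instance [Finite V] : Finite P.InnerFace :=
  inferInstanceAs (Finite {s : P.Face // s ≠ P.outerFace})

theorem edge_mem_faceEdges {f : P.Face} {d : G.Dart} :
    d.edge ∈ P.faceEdges f ↔ P.faceOf d = f ∨ P.faceOf d.symm = f := by
  constructor
  · rintro ⟨d', hd', he⟩
    rcases (SimpleGraph.dart_edge_eq_iff d' d).1 he with rfl | rfl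
    · exact Or.inl hd'
    · exact Or.inr hd'
  · rintro (h | h)
    · exact ⟨d, h, rfl⟩
    · exact ⟨d.symm, h, d.edge_symm⟩

theorem mem_periphery_verts {f : P.Face} {v : V} :
    v ∈ (P.periphery f).verts ↔ ∃ d : G.Dart, d.fst = v ∧ P.faceOf d = f := by
  constructor
  · rintro ⟨e, ⟨d, hd, rfl⟩, hv⟩
    rcases Sym2.mem_iff.1 hv with h | h
    · exact ⟨d, h.symm, hd⟩
    · exact ⟨P.next d, by rw [next_fst, h], by rw [faceOf_next, hd]⟩
  · rintro ⟨d, rfl, hd⟩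
    exact ⟨d.edge, ⟨d, hd, rfl⟩, Sym2.mem_mk_left _ _⟩

/-- Every vertex of an outerplane graph is the tail of a dart along the outer face. -/
theorem IsOuterplane.exists_dart {P : PlaneEmbedding G} (hout : P.IsOuterplane) (v : V) :
    ∃ d : G.Dart, d.fst = v ∧ P.faceOf d = P.outerFace :=
  P.mem_periphery_verts.1 (hout v)

theorem rot_pow_fst (k : ℕ) (d : G.Dart) : ((P.rot ^ k) d).fst = d.fst := by
  induction k with
  | zero => rfl
  | succ k ih => rw [pow_succ', Equiv.Perm.mul_apply, P.rot_fst, ih]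

/-- Two darts with the same tail are related by turning around that vertex; with the least number
of turns, neither of them is met on the way. -/
theorem exists_rot_pow [Finite V] {d₀ d : G.Dart} (h : d₀.fst = d.fst) :
    ∃ k, (P.rot ^ k) d₀ = d ∧ (∀ j < k, (P.rot ^ j) d₀ ≠ d) ∧
      ∀ j, 0 < j → j ≤ k → (P.rot ^ j) d₀ ≠ d₀ := by
  classical
  have : Finite G.Dart := Finite.of_injective _ SimpleGraph.Dart.toProd_injective
  have hex : ∃ k, (P.rot ^ k) d₀ = d := by
    obtain ⟨k, hk⟩ := (P.rot_sameCycle d₀ d h).exists_nat_pow_eq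
    exact ⟨k, hk⟩
  refine ⟨Nat.find hex, Nat.find_spec hex, fun j hj => Nat.find_min hex hj, fun j h0 hj hret => ?_⟩
  refine Nat.find_min hex (m := Nat.find hex - j) (by omega) ?_
  conv_rhs => rw [← Nat.find_spec hex]
  conv_rhs => rw [← Nat.sub_add_cancel hj, pow_add, Equiv.Perm.mul_apply, hret]

/-- Turning around a vertex from the dart `d₀` to another dart `d`: a property which holds after
the first step and is passed on at every intermediate dart holds at `d`. -/
theorem rot_induction [Finite V] {d₀ d : G.Dart} (h : d₀.fst = d.fst) (hne : d₀ ≠ d)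
    (Q : G.Dart → Prop) (h0 : Q (P.rot d₀))
    (hstep : ∀ d', d'.fst = d.fst → d' ≠ d₀ → d' ≠ d → P.rot d' ≠ d₀ → Q d' → Q (P.rot d')) :
    Q d := by
  obtain ⟨k, hk, hmin, hret⟩ := P.exists_rot_pow h
  have key : ∀ j, j + 1 ≤ k → Q ((P.rot ^ (j + 1)) d₀) := by
    intro j
    induction j with
    | zero => intro _; simpa using h0
    | succ j ih =>
      intro hj
      have hne' := hret (j + 1 + 1) (by omega) hj
      rw [pow_succ', Equiv.Perm.mul_apply] at hne' ⊢
      exact hstep _ (by rw [rot_pow_fst, h]) (hret _ (by omega) (by omega)) (hmin _ (by omega))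
        hne' (ih (by omega))
  obtain _ | k := k
  · exact absurd hk hne
  · exact hk ▸ key k le_rfl

/-- A property which does not change while turning around a vertex, except possibly when the dart
`d₀` is reached or left, holds at all other darts with that tail or at none. -/
theorem rot_between [Finite V] {d₀ d₁ d₂ : G.Dart} (h₁ : d₀.fst = d₁.fst) (h₂ : d₀.fst = d₂.fst)
    (hne₁ : d₀ ≠ d₁) (hne₂ : d₀ ≠ d₂) (Q : G.Dart → Prop)
    (hstep : ∀ d', d'.fst = d₀.fst → d' ≠ d₀ → P.rot d' ≠ d₀ → (Q d' ↔ Q (P.rot d'))) :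
    Q d₁ ↔ Q d₂ := by
  have key : ∀ d, d₀.fst = d.fst → d₀ ≠ d → (Q (P.rot d₀) ↔ Q d) := fun d hd hne =>
    P.rot_induction hd hne (fun d' => Q (P.rot d₀) ↔ Q d') Iff.rfl
      fun d' hv h1 _ h2 h3 => h3.trans (hstep d' (hv.trans hd.symm) h1 h2)
  exact (key _ h₁ hne₁).symm.trans (key _ h₂ hne₂)

/-- The dual graph of a plane graph is connected. -/
theorem eq_of_forall_faceOf_eq {α : Type*} (y : P.Face → α)
    (hy : ∀ d, y (P.faceOf d) = y (P.faceOf d.symm)) (f g : P.Face) : y f = y g := by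
  have hvert : ∀ d d' : G.Dart, d.fst = d'.fst → y (P.faceOf d) = y (P.faceOf d') := by
    intro d d' h
    obtain ⟨k, hk⟩ := P.rot_sameCycle d d' h
    have hrot : ∀ e, y (P.faceOf (P.rot e)) = y (P.faceOf e) := fun e => by
      rw [faceOf_rot, hy, SimpleGraph.Dart.symm_symm]
    have : ∀ (k : ℤ) (e : G.Dart), y (P.faceOf ((P.rot ^ k) e)) = y (P.faceOf e) := by
      intro k
      induction k with
      | zero => intro e; rfl
      | succ i ih => intro e; rw [zpow_add_one, Equiv.Perm.mul_apply, ih, hrot]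
      | pred i ih =>
        intro e
        rw [zpow_sub_one, Equiv.Perm.mul_apply, ih, ← hrot, ← Equiv.Perm.mul_apply,
          mul_inv_cancel, Equiv.Perm.one_apply]
    rw [← hk, this]
  have hwalk : ∀ (u v : V) (_ : G.Walk u v) (d d' : G.Dart), d.fst = u → d'.fst = v →
      y (P.faceOf d) = y (P.faceOf d') := by
    intro u v p
    induction p with
    | nil => intro d d' h h'; exact hvert _ _ (h.trans h'.symm)
    | @cons a b c hab p ih =>
      intro d d' h h'
      rw [hvert d ⟨(a, b), hab⟩ h, hy]
      exact ih _ _ rfl h'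
  obtain ⟨d, rfl⟩ := P.exists_faceOf_eq f
  obtain ⟨d', rfl⟩ := P.exists_faceOf_eq g
  obtain ⟨p⟩ := P.connected.preconnected d.fst d'.fst
  exact hwalk _ _ p d d' rfl rfl

/-- The coboundary of a function on the faces: its differences across the edges. -/
noncomputable def faceCoboundary : (P.Face → ZMod 2) →ₗ[ZMod 2] (G.edgeSet → ZMod 2) where
  toFun x e := x (P.faceOf (Classical.choose (exists_dart e))) +
    x (P.faceOf (Classical.choose (exists_dart e)).symm)
  map_add' x y := by ext e; simp only [Pi.add_apply]; ring
  map_smul' r x := by ext e; simp only [Pi.smul_apply, smul_eq_mul, RingHom.id_apply]; ring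
where
  /-- Every edge underlies a dart. -/
  exists_dart (e : G.edgeSet) : ∃ d : G.Dart, d.edge = e.1 := by
    obtain ⟨e, he⟩ := e
    induction e using Sym2.ind with
    | _ u v => exact ⟨⟨(u, v), he⟩, rfl⟩

theorem faceCoboundary_apply (x : P.Face → ZMod 2) (d : G.Dart) :
    P.faceCoboundary x ⟨d.edge, d.edge_mem⟩ = x (P.faceOf d) + x (P.faceOf d.symm) := by
  have h := Classical.choose_spec (faceCoboundary.exists_dart (G := G) ⟨d.edge, d.edge_mem⟩)
  rcases (SimpleGraph.dart_edge_eq_iff _ d).1 h with h | h <;>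
    simp only [faceCoboundary, LinearMap.coe_mk, AddHom.coe_mk]
  · rw [h]
  · rw [h, SimpleGraph.Dart.symm_symm, add_comm]

end PlaneEmbedding

/-! ### Boundaries modulo two -/

section Boundary

open scoped Classical

variable {V : Type*} [Fintype V] {G : SimpleGraph V}

/-- The boundary modulo two of a set of edges, given by its indicator function `z`: the number of
edges of the set at each vertex. -/
noncomputable def SimpleGraph.edgeBoundary (G : SimpleGraph V) (z : Sym2 V → ZMod 2) (v : V) :
    ZMod 2 :=
  ∑ d : G.Dart with d.fst = v, z d.edge

/-- The indicator function of a single edge. -/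
noncomputable def edgeIndicator (e : Sym2 V) : Sym2 V → ZMod 2 :=
  fun e' => if e' = e then 1 else 0

namespace SimpleGraph

theorem edgeBoundary_add (z z' : Sym2 V → ZMod 2) (v : V) :
    G.edgeBoundary (z + z') v = G.edgeBoundary z v + G.edgeBoundary z' v :=
  Finset.sum_add_distrib

theorem edgeBoundary_zero (v : V) : G.edgeBoundary 0 v = 0 :=
  Finset.sum_const_zero

theorem edgeBoundary_edgeIndicator (a : G.Dart) (v : V) :
    G.edgeBoundary (edgeIndicator a.edge) v =
      (if v = a.fst then 1 else 0) + (if v = a.snd then 1 else 0) := by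
  unfold edgeBoundary edgeIndicator
  rw [Finset.sum_ite, Finset.sum_const_zero, add_zero, Finset.filter_filter]
  by_cases h1 : v = a.fst
  · have h2 : v ≠ a.snd := fun h => a.fst_ne_snd (h1.symm.trans h)
    have : (Finset.univ.filter fun d : G.Dart => d.fst = v ∧ d.edge = a.edge) = {a} := by
      ext d
      simp only [Finset.mem_filter, Finset.mem_univ, true_and, Finset.mem_singleton,
        dart_edge_eq_iff]
      constructor
      · rintro ⟨h, rfl | rfl⟩
        · rfl
        · exact absurd h.symm h2
      · rintro rfl
        exact ⟨h1.symm, Or.inl rfl⟩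
    rw [this]
    simp [h1]
  · by_cases h2 : v = a.snd
    · have : (Finset.univ.filter fun d : G.Dart => d.fst = v ∧ d.edge = a.edge) = {a.symm} := by
        ext d
        simp only [Finset.mem_filter, Finset.mem_univ, true_and, Finset.mem_singleton,
          dart_edge_eq_iff]
        constructor
        · rintro ⟨h, rfl | rfl⟩
          · exact absurd h.symm h1
          · rfl
        · rintro rfl
          exact ⟨h2.symm, Or.inr rfl⟩
      rw [this]
      simp [h2]
    · have : (Finset.univ.filter fun d : G.Dart => d.fst = v ∧ d.edge = a.edge) = ∅ := by
        ext d
        simp only [Finset.mem_filter, Finset.mem_univ, true_and, Finset.notMem_empty, iff_false,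
          dart_edge_eq_iff]
        rintro ⟨h, rfl | rfl⟩
        · exact h1 h.symm
        · exact h2 h.symm
      rw [this]
      simp [h1, h2]

/-- The boundary of a walk consists of its two ends. -/
theorem exists_edgeBoundary_eq {u v : V} (p : G.Walk u v) :
    ∃ z : Sym2 V → ZMod 2, (∀ e, e ∉ p.edges → z e = 0) ∧
      ∀ w, G.edgeBoundary z w = (if w = u then 1 else 0) + (if w = v then 1 else 0) := by
  induction p with
  | nil => exact ⟨0, fun _ _ => rfl, fun w => by rw [edgeBoundary_zero, CharTwo.add_self_eq_zero]⟩
  | @cons a b c h p ih =>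
    obtain ⟨z, hz, hb⟩ := ih
    refine ⟨z + edgeIndicator s(a, b), fun e he => ?_, fun w => ?_⟩
    · rw [Walk.edges_cons, List.mem_cons, not_or] at he
      simp [hz e he.2, edgeIndicator, he.1]
    · have := G.edgeBoundary_edgeIndicator ⟨(a, b), h⟩ w
      simp only [Dart.edge_mk] at this
      rw [edgeBoundary_add, hb, this]
      have h2 : ∀ x y z : ZMod 2, x + y + (z + x) = z + y := by decide
      exact h2 _ _ _

end SimpleGraph

namespace PlaneEmbedding

variable (P : PlaneEmbedding G)

/-- The edges across which a function on the faces changes form an even set. -/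
theorem sum_faceOf_add_eq_zero (x : P.Face → ZMod 2) (v : V) :
    ∑ d : G.Dart with d.fst = v, (x (P.faceOf d) + x (P.faceOf d.symm)) = 0 := by
  rw [Finset.sum_add_distrib]
  have : ∑ d : G.Dart with d.fst = v, x (P.faceOf d.symm) =
      ∑ d : G.Dart with d.fst = v, x (P.faceOf d) := by
    refine Finset.sum_equiv P.rot (fun d => ?_) (fun d _ => ?_)
    · simp [P.rot_fst]
    · rw [P.faceOf_rot]
  rw [this, CharTwo.add_self_eq_zero]

/-- **Jordan curve theorem**, modulo two: every even set of edges is the set of edges across which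
a suitable function on the faces changes.  By Euler's formula the even sets and the boundaries of
sets of faces form spaces of the same dimension. -/
theorem exists_face_potential (z : Sym2 V → ZMod 2) (hz : ∀ v, G.edgeBoundary z v = 0) :
    ∃ x : P.Face → ZMod 2, x P.outerFace = 0 ∧
      ∀ d : G.Dart, z d.edge = x (P.faceOf d) + x (P.faceOf d.symm) := by
  have : Fintype P.Face := Fintype.ofFinite _
  let bd : (G.edgeSet → ZMod 2) →ₗ[ZMod 2] (V → ZMod 2) :=
    { toFun := fun y v => ∑ d : G.Dart with d.fst = v, y ⟨d.edge, d.edge_mem⟩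
      map_add' := fun x y => by ext v; simp [Finset.sum_add_distrib]
      map_smul' := fun r x => by ext v; simp [Finset.mul_sum] }
  have hle : LinearMap.range P.faceCoboundary ≤ LinearMap.ker bd := by
    rintro _ ⟨x, rfl⟩
    rw [LinearMap.mem_ker]
    ext v
    change ∑ d : G.Dart with d.fst = v, P.faceCoboundary x ⟨d.edge, d.edge_mem⟩ = 0
    simp only [faceCoboundary_apply]
    exact P.sum_faceOf_add_eq_zero x v
  have hker : Module.finrank (ZMod 2) (LinearMap.ker P.faceCoboundary) ≤ 1 := by
    have hsub : LinearMap.ker P.faceCoboundary ≤ Submodule.span (ZMod 2) {fun _ => 1} := by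
      intro x hx
      rw [Submodule.mem_span_singleton]
      refine ⟨x P.outerFace, ?_⟩
      ext f
      rw [Pi.smul_apply, smul_eq_mul, mul_one]
      refine P.eq_of_forall_faceOf_eq x (fun d => ?_) _ _
      have := congrFun (LinearMap.mem_ker.1 hx) ⟨d.edge, d.edge_mem⟩
      rw [faceCoboundary_apply] at this
      exact CharTwo.add_eq_zero.1 this
    refine (Submodule.finrank_mono hsub).trans ?_
    exact (finrank_span_le_card _).trans (by simp)
  obtain ⟨v₀⟩ := P.connected.nonempty
  have hran : Fintype.card V ≤ Module.finrank (ZMod 2) (LinearMap.range bd) + 1 := by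
    have htop : LinearMap.range bd ⊔ Submodule.span (ZMod 2) {Pi.single v₀ 1} = ⊤ := by
      rw [eq_top_iff, ← (Pi.basisFun (ZMod 2) V).span_eq, Submodule.span_le]
      rintro _ ⟨v, rfl⟩
      obtain ⟨p⟩ := P.connected.preconnected v v₀
      obtain ⟨y, -, hy⟩ := G.exists_edgeBoundary_eq p
      rw [SetLike.mem_coe, Submodule.mem_sup]
      refine ⟨bd fun e => y e.1, ⟨_, rfl⟩, Pi.single v₀ 1, Submodule.mem_span_singleton_self _, ?_⟩
      ext w
      have := hy w
      rw [Pi.add_apply]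
      change G.edgeBoundary y w + _ = _
      rw [this, Pi.basisFun_apply]
      simp only [Pi.single_apply]
      rw [add_assoc, CharTwo.add_self_eq_zero, add_zero]
    have h1 := Submodule.finrank_add_le_finrank_add_finrank (LinearMap.range bd)
      (Submodule.span (ZMod 2) {Pi.single v₀ 1})
    rw [htop, finrank_top, Module.finrank_fintype_fun_eq_card] at h1
    have h2 : Module.finrank (ZMod 2)
        (Submodule.span (ZMod 2) {(Pi.single v₀ 1 : V → ZMod 2)}) ≤ 1 :=
      (finrank_span_le_card _).trans (by simp)
    omega
  have heuler := P.euler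
  change Nat.card V + Nat.card P.Face = _ at heuler
  have hr1 := LinearMap.finrank_range_add_finrank_ker P.faceCoboundary
  have hr2 := LinearMap.finrank_range_add_finrank_ker bd
  rw [Module.finrank_fintype_fun_eq_card, ← Nat.card_eq_fintype_card] at hr1 hr2
  rw [← Nat.card_eq_fintype_card] at hran
  have heq := Submodule.eq_of_le_of_finrank_le hle (by omega)
  have hmem : (fun e : G.edgeSet => z e.1) ∈ LinearMap.ker bd := by
    rw [LinearMap.mem_ker]
    ext v
    exact hz v
  rw [← heq] at hmem
  obtain ⟨x, hx⟩ := hmem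
  refine ⟨fun f => x f + x P.outerFace, CharTwo.add_self_eq_zero _, fun d => ?_⟩
  have := congrFun hx ⟨d.edge, d.edge_mem⟩
  rw [faceCoboundary_apply] at this
  rw [← this]
  have h2 : ∀ a b c : ZMod 2, a + b = a + c + (b + c) := by decide
  exact h2 _ _ _

end PlaneEmbedding

end Boundary

/-! ### Faces of 2-connected plane graphs -/

section TwoConnected

open scoped Classical

variable {V : Type*} [Fintype V] {G : SimpleGraph V}

/-- In a 2-connected graph any two edges at a vertex lie on a common cycle. -/
theorem SimpleGraph.IsTwoConnected.exists_cycle (hG : G.IsTwoConnected) {a b : G.Dart}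
    (hab : a.fst = b.fst) :
    ∃ z : Sym2 V → ZMod 2, (∀ v, G.edgeBoundary z v = 0) ∧
      ∀ d : G.Dart, d.fst = a.fst →
        z d.edge = (if d = a then 1 else 0) + (if d = b then 1 else 0) := by
  obtain ⟨p⟩ := (hG.2.2 a.fst).preconnected ⟨a.snd, a.snd_ne_fst⟩ ⟨b.snd, hab ▸ b.snd_ne_fst⟩
  obtain ⟨z, hz, hb⟩ :=
    SimpleGraph.exists_edgeBoundary_eq (p.map (SimpleGraph.Embedding.induce _).toHom)
  replace hb : ∀ w, G.edgeBoundary z w =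
    (if w = a.snd then 1 else 0) + (if w = b.snd then 1 else 0) := hb
  refine ⟨z + edgeIndicator a.edge + edgeIndicator b.edge, fun v => ?_, fun d hd => ?_⟩
  · rw [SimpleGraph.edgeBoundary_add, SimpleGraph.edgeBoundary_add, hb,
      SimpleGraph.edgeBoundary_edgeIndicator, SimpleGraph.edgeBoundary_edgeIndicator, ← hab]
    have h2 : ∀ x y z : ZMod 2, x + y + (z + x) + (z + y) = 0 := by decide
    exact h2 _ _ _
  · have hz0 : z d.edge = 0 := by
      refine hz _ fun hmem => ?_
      have h1 : d.fst ∈ (p.map (SimpleGraph.Embedding.induce {a.fst}ᶜ).toHom).support :=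
        SimpleGraph.Walk.fst_mem_support_of_mem_edges _ hmem
      rw [SimpleGraph.Walk.support_map, List.mem_map] at h1
      obtain ⟨⟨w, hw⟩, -, hw'⟩ := h1
      exact hw (hw'.trans hd)
    have key : ∀ c : G.Dart, d.fst = c.fst →
        edgeIndicator c.edge d.edge = if d = c then 1 else 0 := by
      intro c hc
      unfold edgeIndicator
      refine if_congr ?_ rfl rfl
      rw [SimpleGraph.dart_edge_eq_iff]
      refine ⟨fun h => h.resolve_right fun h => ?_, Or.inl⟩
      rw [h] at hc
      exact c.snd_ne_fst hc
    rw [Pi.add_apply, Pi.add_apply, hz0, zero_add, key a hd, key b (hd.trans hab)]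

theorem SimpleGraph.IsTwoConnected.exists_dart_ne (hG : G.IsTwoConnected) (a : G.Dart) :
    ∃ b : G.Dart, b.fst = a.fst ∧ b ≠ a := by
  obtain ⟨w, hw⟩ : ∃ w, w ≠ a.fst ∧ w ≠ a.snd := by
    by_contra! h
    have h3 := hG.1
    rw [Nat.card_eq_fintype_card] at h3
    have : (Finset.univ : Finset V) ⊆ {a.fst, a.snd} := by
      intro w _
      by_cases hw : w = a.fst
      · simp [hw]
      · simp [h w hw]
    have := (Finset.card_le_card this).trans Finset.card_le_two
    rw [Finset.card_univ] at this
    omega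
  obtain ⟨p⟩ := (hG.2.2 a.snd).preconnected ⟨a.fst, a.fst_ne_snd⟩ ⟨w, hw.2⟩
  cases p with
  | nil => exact absurd rfl hw.1
  | @cons _ u _ h p =>
    refine ⟨⟨(a.fst, u.1), h⟩, rfl, fun hh => u.2 ?_⟩
    exact congrArg (fun d : G.Dart => d.snd) hh

namespace PlaneEmbedding

variable (P : PlaneEmbedding G)

/-- In a 2-connected plane graph, every vertex appears at most once on the boundary of a face.
Otherwise the cycle through the edges of two such corners would separate the face from itself. -/
theorem dart_ext (hG : G.IsTwoConnected) {d₁ d₂ : G.Dart} (hv : d₁.fst = d₂.fst)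
    (hf : P.faceOf d₁ = P.faceOf d₂) : d₁ = d₂ := by
  by_contra hne
  obtain ⟨z, hz, hzv⟩ := hG.exists_cycle hv
  obtain ⟨x, -, hx⟩ := P.exists_face_potential z hz
  have hstep : ∀ d, x (P.faceOf (P.rot d)) = x (P.faceOf d) + z d.edge := by
    intro d
    rw [hx, faceOf_rot, ← add_assoc, CharTwo.add_self_eq_zero, zero_add]
  have h : x (P.faceOf d₂) = x (P.faceOf d₁) + 1 := by
    refine P.rot_induction hv hne (fun d => x (P.faceOf d) = x (P.faceOf d₁) + 1) ?_ ?_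
    · rw [hstep, hzv _ rfl, if_pos rfl, if_neg hne, add_zero]
    · intro d hd h1 h2 _ h
      rw [hstep, hzv _ (hd.trans hv.symm), if_neg h1, if_neg h2, h, add_zero, add_zero]
  rw [hf] at h
  exact absurd h (by generalize x _ = y; revert y; decide)

/-- The two sides of an edge of a 2-connected plane graph are different faces. -/
theorem faceOf_ne_faceOf_symm (hG : G.IsTwoConnected) (d : G.Dart) :
    P.faceOf d ≠ P.faceOf d.symm := by
  intro h
  rw [← faceOf_rot] at h
  have hrot := P.dart_ext hG (P.rot_fst d).symm h
  obtain ⟨b, hb, hne⟩ := hG.exists_dart_ne d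
  obtain ⟨k, hk⟩ := P.rot_sameCycle d b hb.symm
  refine hne ?_
  rw [← hk, Equiv.Perm.zpow_apply_eq_self_of_apply_eq_self hrot.symm]

/-! ### The inner dual of a 2-connected outerplane graph -/

/-- Every chord of an outerplane graph separates the inner faces: some set `X` of inner faces
contains only one of the two faces at the chord, and no other chord lies on its border. -/
theorem exists_separation (hout : P.IsOuterplane) (e : G.Dart)
    (h₁ : P.faceOf e ≠ P.outerFace) (h₂ : P.faceOf e.symm ≠ P.outerFace) :
    ∃ X : Set P.Face, P.faceOf e ∈ X ∧ P.faceOf e.symm ∉ X ∧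
      ∀ d : G.Dart, P.faceOf d ≠ P.outerFace → P.faceOf d.symm ≠ P.outerFace → d ≠ e →
        d ≠ e.symm → (P.faceOf d ∈ X ↔ P.faceOf d.symm ∈ X) := by
  -- the chord and one of the two parts of the outer cycle between its ends form a cycle
  obtain ⟨z, hzero, hz⟩ : ∃ z : Sym2 V → ZMod 2, (∀ d : G.Dart, P.faceOf d ≠ P.outerFace →
      P.faceOf d.symm ≠ P.outerFace → z d.edge = 0) ∧ ∀ w, G.edgeBoundary z w =
        (if w = e.fst then 1 else 0) + (if w = e.snd then 1 else 0) := by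
    obtain ⟨a, ha, hao⟩ := hout.exists_dart e.fst
    obtain ⟨b, hb, hbo⟩ := hout.exists_dart e.snd
    obtain ⟨k, hk⟩ := (P.faceOf_eq_iff.1 (hao.trans hbo.symm)).exists_nat_pow_eq
    rw [← ha, ← hb, ← hk]
    clear hk ha hb
    induction k with
    | zero =>
      refine ⟨0, fun _ _ _ => rfl, fun w => ?_⟩
      rw [SimpleGraph.edgeBoundary_zero, pow_zero, Equiv.Perm.one_apply,
        CharTwo.add_self_eq_zero]
    | succ k ih =>
      obtain ⟨z, hzero, hz⟩ := ih
      have hface : P.faceOf ((P.next ^ k) a) = P.outerFace := by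
        rw [← hao, faceOf_eq_iff]
        exact ⟨-k, by simp⟩
      refine ⟨z + edgeIndicator ((P.next ^ k) a).edge, fun d h h' => ?_, fun w => ?_⟩
      · rw [Pi.add_apply, hzero d h h', edgeIndicator, if_neg, add_zero]
        intro hd
        rcases (SimpleGraph.dart_edge_eq_iff _ _).1 hd with rfl | rfl
        · exact h hface
        · rw [SimpleGraph.Dart.symm_symm] at h'
          exact h' hface
      · rw [SimpleGraph.edgeBoundary_add, hz, SimpleGraph.edgeBoundary_edgeIndicator, pow_succ',
          Equiv.Perm.mul_apply, next_fst]
        have h2 : ∀ x y z : ZMod 2, x + y + (y + z) = x + z := by decide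
        exact h2 _ _ _
  obtain ⟨x, -, hx⟩ := P.exists_face_potential (z + edgeIndicator e.edge) fun w => by
    rw [SimpleGraph.edgeBoundary_add, hz, SimpleGraph.edgeBoundary_edgeIndicator,
      CharTwo.add_self_eq_zero]
  refine ⟨{f | x f = x (P.faceOf e)}, rfl, fun h => ?_, fun d hd hd' hne hne' => ?_⟩
  · change x (P.faceOf e.symm) = x (P.faceOf e) at h
    have := hx e
    rw [Pi.add_apply, hzero e h₁ h₂, edgeIndicator, if_pos rfl, h,
      CharTwo.add_self_eq_zero] at this
    exact absurd this (by decide)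
  · have := hx d
    rw [Pi.add_apply, hzero d hd hd', edgeIndicator, if_neg, add_zero, eq_comm,
      CharTwo.add_eq_zero] at this
    · change x _ = _ ↔ x _ = _
      rw [this]
    · rw [SimpleGraph.dart_edge_eq_iff, not_or]
      exact ⟨hne, hne'⟩

/-- A set of inner faces which is closed under crossing chords contains all inner faces or none:
its border is an even subset of the edges of the outer cycle. -/
theorem mem_iff_mem_of_chord (hG : G.IsTwoConnected) (X : Set P.Face)
    (hX : ∀ d : G.Dart, P.faceOf d ≠ P.outerFace → P.faceOf d.symm ≠ P.outerFace →
      (P.faceOf d ∈ X ↔ P.faceOf d.symm ∈ X)) (s t : P.InnerFace) : s.1 ∈ X ↔ t.1 ∈ X := by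
  let x : P.Face → ZMod 2 := fun f => if f ∈ X ∧ f ≠ P.outerFace then 1 else 0
  have hxo : x P.outerFace = 0 := if_neg fun h => h.2 rfl
  have hstep : ∀ d : G.Dart, P.faceOf d = P.outerFace →
      x (P.faceOf (P.next d).symm) = x (P.faceOf d.symm) := by
    intro d hd
    have hsum := P.sum_faceOf_add_eq_zero x d.snd
    have hne : d.symm ≠ P.next d := by
      intro h
      refine P.faceOf_ne_faceOf_symm hG d ?_
      rw [h, faceOf_next]
    rw [← Finset.sum_subset (s₁ := {d.symm, P.next d}), Finset.sum_pair hne, faceOf_next, hd, hxo,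
      SimpleGraph.Dart.symm_symm, hd, hxo, add_zero, zero_add, CharTwo.add_eq_zero] at hsum
    · exact hsum.symm
    · intro d' h
      rw [Finset.mem_insert, Finset.mem_singleton] at h
      rcases h with rfl | rfl
      · exact Finset.mem_filter.2 ⟨Finset.mem_univ _, rfl⟩
      · exact Finset.mem_filter.2 ⟨Finset.mem_univ _, P.next_fst d⟩
    · intro d' h h'
      rw [Finset.mem_insert, Finset.mem_singleton, not_or] at h'
      have hv : d'.fst = d.snd := (Finset.mem_filter.1 h).2
      have h1 : P.faceOf d' ≠ P.outerFace := fun h1 => h'.2 <|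
        P.dart_ext hG (hv.trans (P.next_fst d).symm) (by rw [h1, faceOf_next, hd])
      have h2 : P.faceOf d'.symm ≠ P.outerFace := by
        intro h2
        -- both `d'.symm` and `d` run along the outer face and have the same head
        have : P.next d'.symm = P.next d := P.dart_ext hG
          (by rw [next_fst, next_fst]; exact hv) (by rw [faceOf_next, faceOf_next, h2, hd])
        have := P.next.injective this
        exact h'.1 (by rw [← this, SimpleGraph.Dart.symm_symm])
      have : x (P.faceOf d') = x (P.faceOf d'.symm) :=
        if_congr (and_congr (hX d' h1 h2) (iff_of_true h1 h2)) rfl rfl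
      rw [this, CharTwo.add_self_eq_zero]
  obtain ⟨a, ha⟩ := P.exists_faceOf_eq P.outerFace
  have hconst : ∀ d : G.Dart, P.faceOf d = P.outerFace →
      x (P.faceOf d.symm) = x (P.faceOf a.symm) := by
    intro d hd
    obtain ⟨k, hk⟩ := (P.faceOf_eq_iff.1 (ha.trans hd.symm)).exists_nat_pow_eq
    rw [← hk]
    clear hk
    induction k with
    | zero => rfl
    | succ k ih =>
      rw [pow_succ', Equiv.Perm.mul_apply, hstep, ih]
      rw [← ha, faceOf_eq_iff]
      exact ⟨-k, by simp⟩
  -- the outer face gets the common value of `x` on the faces at the outer cycle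
  let y : P.Face → ZMod 2 := fun f => if f = P.outerFace then x (P.faceOf a.symm) else x f
  have hy := P.eq_of_forall_faceOf_eq y (fun d => by
    by_cases h1 : P.faceOf d = P.outerFace
    · have h2 : P.faceOf d.symm ≠ P.outerFace := fun h2 =>
        P.faceOf_ne_faceOf_symm hG d (h1.trans h2.symm)
      simp only [y, if_pos h1, if_neg h2, hconst d h1]
    · by_cases h2 : P.faceOf d.symm = P.outerFace
      · have := hconst d.symm h2
        rw [SimpleGraph.Dart.symm_symm] at this
        simp only [y, if_neg h1, if_pos h2, this]
      · simp only [y, if_neg h1, if_neg h2, x]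
        exact if_congr (and_congr (hX d h1 h2) (iff_of_true h1 h2)) rfl rfl) s.1 t.1
  simp only [y, if_neg s.2, if_neg t.2, x, ne_eq, s.2, t.2, not_false_eq_true, and_true] at hy
  by_cases h1 : s.1 ∈ X <;> by_cases h2 : t.1 ∈ X <;> simp_all

theorem innerDual_adj_iff (hG : G.IsTwoConnected) {s t : P.InnerFace} :
    P.innerDual.Adj s t ↔ ∃ d : G.Dart, P.faceOf d = s.1 ∧ P.faceOf d.symm = t.1 := by
  constructor
  · rintro ⟨hne, e, ⟨d, hd, rfl⟩, ht⟩
    rcases P.edge_mem_faceEdges.1 ht with h | h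
    · exact absurd (Subtype.ext (hd.symm.trans h)) hne
    · exact ⟨d, hd, h⟩
  · rintro ⟨d, hd, hd'⟩
    refine ⟨fun h => P.faceOf_ne_faceOf_symm hG d (by rw [hd, hd', h]), d.edge, ⟨d, hd, rfl⟩, ?_⟩
    exact P.edge_mem_faceEdges.2 (Or.inr hd')

theorem innerDual_preconnected (hG : G.IsTwoConnected) :
    P.innerDual.Preconnected := by
  intro s t
  have := P.mem_iff_mem_of_chord hG {f | ∃ h : f ≠ P.outerFace, P.innerDual.Reachable s ⟨f, h⟩}
    (fun d h h' => by
      have hadj : P.innerDual.Adj ⟨_, h⟩ ⟨_, h'⟩ := (P.innerDual_adj_iff hG).2 ⟨d, rfl, rfl⟩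
      exact ⟨fun ⟨_, hr⟩ => ⟨h', hr.trans hadj.reachable⟩,
        fun ⟨_, hr⟩ => ⟨h, hr.trans hadj.symm.reachable⟩⟩) s t
  exact (this.1 ⟨s.2, SimpleGraph.Reachable.refl _⟩).2

theorem nonempty_innerFace (hG : G.IsTwoConnected) : Nonempty P.InnerFace := by
  obtain ⟨d, hd⟩ := P.exists_faceOf_eq P.outerFace
  exact ⟨⟨P.faceOf d.symm, fun h => P.faceOf_ne_faceOf_symm hG d (hd.trans h.symm)⟩⟩

end PlaneEmbedding

end TwoConnected

/-! ### Perfect matchings as sets of inner faces -/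

/-- A set of elements is closed under a relation `A` if it contains, with the head of an arc of
`A`, also its tail. -/
def ArcClosed {F : Type*} (A : F → F → Prop) (S : Set F) : Prop :=
  ∀ a b, A a b → b ∈ S → a ∈ S

namespace PlaneEmbedding

variable {V : Type*} {G : SimpleGraph V} (P : PlaneEmbedding G)

/-- The colouring obtained from `c` by exchanging black and white. -/
def swapColour (c : G.Coloring Colour) : G.Coloring Colour :=
  SimpleGraph.Coloring.mk (fun v => !c v) fun h heq => c.valid h (Bool.not_inj heq)

theorem swapColour_apply (c : G.Coloring Colour) (v : V) : swapColour c v = !c v := rfl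

theorem colour_snd (c : G.Coloring Colour) (d : G.Dart) : c d.snd = !c d.fst :=
  Bool.eq_not_of_ne (c.valid d.adj).symm

theorem white_or_symm_white (c : G.Coloring Colour) (d : G.Dart) :
    c d.fst = Colour.white ∨ c d.symm.fst = Colour.white := by
  have : c d.symm.fst = !c d.fst := colour_snd c d
  rw [this]
  cases c d.fst <;> simp

/-- A set of inner faces, as a set of faces. -/
def faceSet (S : Set P.InnerFace) : Set P.Face :=
  {f | ∃ h : f ≠ P.outerFace, (⟨f, h⟩ : P.InnerFace) ∈ S}

/-- The orientation of the inner dual given by a colouring: there is an arc from `a` to `b` if, on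
a common edge directed from its white to its black end, `a` lies to the right and `b` to the
left. -/
def DualArc (c : G.Coloring Colour) (a b : P.InnerFace) : Prop :=
  ∃ d : G.Dart, c d.fst = Colour.white ∧ P.faceOf d = a.1 ∧ P.faceOf d.symm = b.1

/-- Directed from white to black, the dart `d` descends from `S`: the face to its right belongs
to `S` and the face to its left does not.  Here the outer face counts as an element of `S` on the
right hand side of a dart, and as a non-element on the left hand side. -/
def Descends (S : Set P.InnerFace) (d : G.Dart) : Prop :=
  P.faceOf d ∉ P.faceSet Sᶜ ∧ P.faceOf d.symm ∉ P.faceSet S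

/-- The set `S` of inner faces encodes the perfect matching `M` if `M` consists of the edges which,
directed from white to black, descend from `S`. -/
def Encodes (c : G.Coloring Colour) (M : G.PerfectMatching) (S : Set P.InnerFace) : Prop :=
  ∀ d : G.Dart, c d.fst = Colour.white → (d.edge ∈ M.edges ↔ P.Descends S d)

variable {P}

theorem mem_faceSet {S : Set P.InnerFace} {s : P.InnerFace} : s.1 ∈ P.faceSet S ↔ s ∈ S :=
  ⟨fun ⟨_, h⟩ => h, fun h => ⟨s.2, h⟩⟩

theorem outerFace_notMem_faceSet {S : Set P.InnerFace} : P.outerFace ∉ P.faceSet S :=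
  fun h => h.1 rfl

theorem mem_faceSet_compl {S : Set P.InnerFace} {f : P.Face} :
    f ∈ P.faceSet Sᶜ ↔ f ≠ P.outerFace ∧ f ∉ P.faceSet S := by
  constructor
  · rintro ⟨h, hS⟩
    exact ⟨h, fun ⟨_, h'⟩ => hS h'⟩
  · rintro ⟨h, hS⟩
    exact ⟨h, fun h' => hS ⟨h, h'⟩⟩

theorem descends_compl_iff {S : Set P.InnerFace} {d : G.Dart} :
    P.Descends Sᶜ d.symm ↔ P.Descends S d := by
  rw [Descends, Descends, compl_compl, SimpleGraph.Dart.symm_symm, and_comm]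

theorem dualArc_swapColour {c : G.Coloring Colour} {a b : P.InnerFace} :
    P.DualArc (swapColour c) a b ↔ P.DualArc c b a := by
  have key : ∀ (c : G.Coloring Colour) (a b : P.InnerFace),
      P.DualArc (swapColour c) a b → P.DualArc c b a := by
    rintro c a b ⟨d, hd, ha, hb⟩
    refine ⟨d.symm, ?_, hb, by rwa [SimpleGraph.Dart.symm_symm]⟩
    exact (colour_snd c d).trans hd
  refine ⟨key c a b, fun h => key _ _ _ ?_⟩
  have : swapColour (swapColour c) = c := by
    ext v
    simp [swapColour_apply]
  rwa [this]

theorem arcClosed_swapColour {c : G.Coloring Colour} {S : Set P.InnerFace}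
    (hS : ArcClosed (P.DualArc c) S) : ArcClosed (P.DualArc (swapColour c)) Sᶜ :=
  fun a b hab hb ha => hb (hS b a (dualArc_swapColour.1 hab) ha)

theorem Encodes.swapColour {c : G.Coloring Colour} {M : G.PerfectMatching} {S : Set P.InnerFace}
    (h : P.Encodes c M S) : P.Encodes (swapColour c) M Sᶜ := by
  intro d hd
  rw [← d.edge_symm, h d.symm ((colour_snd c d).trans hd), ← descends_compl_iff,
    SimpleGraph.Dart.symm_symm]

theorem mem_faceSet_of_arcClosed {c : G.Coloring Colour} {S : Set P.InnerFace}
    (hS : ArcClosed (P.DualArc c) S) {d : G.Dart} (hd : c d.fst = Colour.white)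
    (h : P.faceOf d ≠ P.outerFace) (h' : P.faceOf d.symm ∈ P.faceSet S) :
    P.faceOf d ∈ P.faceSet S :=
  ⟨h, hS _ ⟨_, h'.1⟩ ⟨d, hd, rfl, rfl⟩ h'.2⟩

/-- A set of inner faces is determined by its border. -/
theorem eq_of_border_eq {U W : Set P.InnerFace}
    (h : ∀ d : G.Dart, ((P.faceOf d ∈ P.faceSet U ↔ P.faceOf d.symm ∈ P.faceSet U) ↔
      (P.faceOf d ∈ P.faceSet W ↔ P.faceOf d.symm ∈ P.faceSet W))) : U = W := by
  ext s
  have := P.eq_of_forall_faceOf_eq (fun f => (f ∈ P.faceSet U ↔ f ∈ P.faceSet W))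
    (fun d => propext (by have := h d; tauto)) s.1 P.outerFace
  simp only [outerFace_notMem_faceSet, mem_faceSet, iff_self, eq_iff_iff, iff_true] at this
  exact this

/-- The symmetric difference of two perfect matchings is the border of the symmetric difference
of the sets which encode them. -/
theorem mem_symmDiff_edges_iff {c : G.Coloring Colour} {M N : G.PerfectMatching}
    {S T : Set P.InnerFace}
    (hS : ArcClosed (P.DualArc c) S) (hMS : P.Encodes c M S) (hT : ArcClosed (P.DualArc c) T)
    (hNT : P.Encodes c N T)
    (d : G.Dart) :
    d.edge ∈ symmDiff M.edges N.edges ↔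
      ¬ (P.faceOf d ∈ P.faceSet (symmDiff S T) ↔ P.faceOf d.symm ∈ P.faceSet (symmDiff S T)) := by
  have hsymm : ∀ f, f ∈ P.faceSet (symmDiff S T) ↔ ¬ (f ∈ P.faceSet S ↔ f ∈ P.faceSet T) := by
    intro f
    by_cases hf : f = P.outerFace
    · subst hf
      simp [outerFace_notMem_faceSet]
    · obtain ⟨s, rfl⟩ : ∃ s : P.InnerFace, s.1 = f := ⟨⟨f, hf⟩, rfl⟩
      rw [mem_faceSet, mem_faceSet, mem_faceSet, Set.mem_symmDiff]
      tauto
  have key : ∀ d : G.Dart, c d.fst = Colour.white → (d.edge ∈ symmDiff M.edges N.edges ↔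
      ¬ (P.faceOf d ∈ P.faceSet (symmDiff S T) ↔
        P.faceOf d.symm ∈ P.faceSet (symmDiff S T))) := by
    intro d hd
    have h1 := fun h => mem_faceSet_of_arcClosed hS hd h
    have h2 := fun h => mem_faceSet_of_arcClosed hT hd h
    rw [hsymm, hsymm, Set.mem_symmDiff, hMS d hd, hNT d hd, Descends, Descends, mem_faceSet_compl,
      mem_faceSet_compl]
    by_cases ho : P.faceOf d = P.outerFace
    · have h3 : P.faceOf d ∉ P.faceSet S := fun h => h.1 ho
      have h4 : P.faceOf d ∉ P.faceSet T := fun h => h.1 ho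
      clear hMS hNT hsymm
      grind
    · have h3 := h1 ho
      have h4 := h2 ho
      clear hMS hNT hsymm
      grind
  rcases white_or_symm_white c d with h | h
  · exact key d h
  · have := key d.symm h
    rw [SimpleGraph.Dart.edge_symm, SimpleGraph.Dart.symm_symm] at this
    rw [this, Iff.comm (a := P.faceOf d ∈ _)]

end PlaneEmbedding

namespace SimpleGraph.PerfectMatching

variable {V : Type*} {G : SimpleGraph V}

theorem ext_edges {M N : G.PerfectMatching} (h : M.edges = N.edges) : M = N := by
  refine Subtype.ext (Subgraph.ext ?_ ?_)
  · rw [M.2.2.verts_eq_univ, N.2.2.verts_eq_univ]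
  · ext u v
    have := Set.ext_iff.1 h s(u, v)
    exact this

theorem existsUnique_dart (M : G.PerfectMatching) (v : V) :
    ∃! d : G.Dart, d.fst = v ∧ d.edge ∈ M.edges := by
  obtain ⟨w, hw, huniq⟩ := Subgraph.isPerfectMatching_iff.1 M.2 v
  refine ⟨⟨(v, w), M.1.adj_sub hw⟩, ⟨rfl, hw⟩, ?_⟩
  rintro d ⟨rfl, hd⟩
  exact Dart.ext _ _ (Prod.ext rfl (huniq _ hd))

theorem dart_ext (M : G.PerfectMatching) {d d' : G.Dart} (h : d.fst = d'.fst)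
    (hd : d.edge ∈ M.edges) (hd' : d'.edge ∈ M.edges) : d = d' :=
  (M.existsUnique_dart d.fst).unique ⟨rfl, hd⟩ ⟨h.symm, hd'⟩

end SimpleGraph.PerfectMatching

section Encoding

open scoped Classical

variable {V : Type*} [Fintype V] {G : SimpleGraph V}

theorem SimpleGraph.PerfectMatching.edgeBoundary_eq_one (M : G.PerfectMatching) (v : V) :
    G.edgeBoundary (fun e => if e ∈ M.edges then 1 else 0) v = 1 := by
  obtain ⟨d, ⟨hd, hM⟩, huniq⟩ := M.existsUnique_dart v
  unfold SimpleGraph.edgeBoundary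
  rw [Finset.sum_eq_single_of_mem d (Finset.mem_filter.2 ⟨Finset.mem_univ _, hd⟩)]
  · exact if_pos hM
  · intro d' hd' hne
    exact if_neg fun h => hne (huniq _ ⟨(Finset.mem_filter.1 hd').2, h⟩)

namespace PlaneEmbedding

variable {P : PlaneEmbedding G}

/-- Around a white vertex, starting from the outer face, the faces in a closed set `S` come
first. So exactly one edge at the vertex descends from `S`. -/
theorem existsUnique_descends (hG : G.IsTwoConnected) (hout : P.IsOuterplane)
    {c : G.Coloring Colour} {S : Set P.InnerFace} (hS : ArcClosed (P.DualArc c) S) {v : V}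
    (hv : c v = Colour.white) : ∃! d : G.Dart, d.fst = v ∧ P.Descends S d := by
  obtain ⟨a, rfl, ha⟩ := hout.exists_dart v
  have hinner : ∀ d : G.Dart, d.fst = a.fst → d ≠ a → P.faceOf d ≠ P.outerFace :=
    fun d hd hne h => hne (P.dart_ext hG hd (h.trans ha.symm))
  refine existsUnique_of_exists_of_unique ?_ ?_
  · by_contra! hnone
    have hstep : ∀ d : G.Dart, d.fst = a.fst → P.faceOf d ∉ P.faceSet Sᶜ →
        P.faceOf (P.rot d) ∈ P.faceSet S := by
      intro d hd h
      by_contra h'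
      rw [faceOf_rot] at h'
      exact hnone d hd ⟨h, h'⟩
    have hstep' : ∀ d : G.Dart, d.fst = a.fst → P.faceOf d ∈ P.faceSet S →
        P.faceOf (P.rot d) ∈ P.faceSet S :=
      fun d hd h => hstep d hd fun h' => (mem_faceSet_compl.1 h').2 h
    have h0 : P.faceOf (P.rot a) ∈ P.faceSet S :=
      hstep a rfl (by rw [ha]; exact outerFace_notMem_faceSet)
    -- the last dart before the turn comes back to `a`
    obtain ⟨b, hb⟩ := P.rot.surjective a
    have hbv : a.fst = b.fst := by rw [← hb, P.rot_fst]
    have hab : a ≠ b := by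
      rintro rfl
      rw [hb, ha] at h0
      exact outerFace_notMem_faceSet h0
    have h1 := P.rot_induction hbv hab (fun d => P.faceOf d ∈ P.faceSet S) h0
      fun d hd _ _ _ h => hstep' d (hd.trans hbv.symm) h
    have h2 := hstep' b hbv.symm h1
    rw [hb, ha] at h2
    exact outerFace_notMem_faceSet h2
  -- after a descent, all faces up to the return to the outer face are outside `S`
  · have key : ∀ d₁ d₂ : G.Dart, ∀ k₁ k₂ : ℕ, (P.rot ^ k₁) a = d₁ → (P.rot ^ k₂) a = d₂ →
        (∀ j, 0 < j → j ≤ k₂ → (P.rot ^ j) a ≠ a) → k₁ < k₂ → P.Descends S d₁ →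
        ¬ P.Descends S d₂ := by
      rintro d₁ d₂ k₁ k₂ rfl rfl hret hlt h₁ h₂
      have hlow : ∀ j, k₁ + 1 + j ≤ k₂ →
          P.faceOf ((P.rot ^ (k₁ + 1 + j)) a) ∉ P.faceSet S := by
        intro j
        induction j with
        | zero =>
          intro _
          rw [add_zero, pow_succ', Equiv.Perm.mul_apply, faceOf_rot]
          exact h₁.2
        | succ j ih =>
          intro hj h
          rw [← add_assoc, pow_succ', Equiv.Perm.mul_apply, faceOf_rot] at h
          refine ih (by omega) (mem_faceSet_of_arcClosed hS ?_ ?_ h)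
          · rw [rot_pow_fst, hv]
          · exact hinner _ (rot_pow_fst _ _ _) (hret _ (by omega) (by omega))
      have h3 := hlow (k₂ - (k₁ + 1)) (by omega)
      rw [show k₁ + 1 + (k₂ - (k₁ + 1)) = k₂ by omega] at h3
      exact h₂.1 (mem_faceSet_compl.2
        ⟨hinner _ (rot_pow_fst _ _ _) (hret _ (by omega) le_rfl), h3⟩)
    rintro d₁ d₂ ⟨hd₁, h₁⟩ ⟨hd₂, h₂⟩
    obtain ⟨k₁, hk₁, -, hr₁⟩ := P.exists_rot_pow hd₁.symm
    obtain ⟨k₂, hk₂, -, hr₂⟩ := P.exists_rot_pow hd₂.symm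
    rcases lt_trichotomy k₁ k₂ with h | rfl | h
    · exact absurd h₂ (key _ _ _ _ hk₁ hk₂ hr₂ h h₁)
    · rw [← hk₁, hk₂]
    · exact absurd h₁ (key _ _ _ _ hk₂ hk₁ hr₁ h h₂)

/-- Every closed set of inner faces encodes a perfect matching. -/
theorem exists_matching_encoded (hG : G.IsTwoConnected) (hout : P.IsOuterplane)
    {c : G.Coloring Colour} {S : Set P.InnerFace} (hS : ArcClosed (P.DualArc c) S) :
    ∃ M : G.PerfectMatching, P.Encodes c M S := by
  let M : G.Subgraph :=
    { verts := Set.univ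
      Adj := fun u v => ∃ d : G.Dart, c d.fst = Colour.white ∧ P.Descends S d ∧ d.edge = s(u, v)
      adj_sub := by
        rintro u v ⟨d, -, -, hd⟩
        have h := d.edge_mem
        rwa [hd, SimpleGraph.mem_edgeSet] at h
      edge_vert := fun _ => Set.mem_univ _
      symm := ⟨by
        rintro u v ⟨d, h1, h2, hd⟩
        exact ⟨d, h1, h2, by rw [hd, Sym2.eq_swap]⟩⟩ }
  have hM : M.IsPerfectMatching := by
    rw [SimpleGraph.Subgraph.isPerfectMatching_iff]
    intro v
    by_cases hv : c v = Colour.white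
    · obtain ⟨d, ⟨rfl, hd⟩, huniq⟩ := existsUnique_descends hG hout hS hv
      refine ⟨d.snd, ⟨d, hv, hd, rfl⟩, ?_⟩
      rintro w ⟨d', hd', hdesc, he⟩
      rcases SimpleGraph.dart_edge_eq_mk'_iff'.1 he with ⟨h1, h2⟩ | ⟨h1, h2⟩
      · rw [← huniq d' ⟨h1, hdesc⟩, h2]
      · have := colour_snd c d'
        rw [h2, hv, hd'] at this
        exact absurd this (by decide)
    · have hv' : swapColour c v = Colour.white := by
        rw [swapColour_apply]
        cases h : c v
        · rfl
        · exact absurd h hv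
      obtain ⟨d, ⟨rfl, hd⟩, huniq⟩ := existsUnique_descends hG hout (arcClosed_swapColour hS) hv'
      refine ⟨d.snd, ⟨d.symm, (colour_snd c d).trans hv', ?_, ?_⟩, ?_⟩
      · rwa [← descends_compl_iff, SimpleGraph.Dart.symm_symm]
      · exact d.edge_symm
      · rintro w ⟨d', hd', hdesc, he⟩
        rcases SimpleGraph.dart_edge_eq_mk'_iff'.1 he with ⟨h1, h2⟩ | ⟨h1, h2⟩
        · exact absurd (h1 ▸ hd') hv
        · rw [← huniq d'.symm ⟨h2, descends_compl_iff.2 hdesc⟩]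
          exact h1.symm
  refine ⟨⟨M, hM⟩, fun d hd => ⟨?_, fun h => ⟨d, hd, h, rfl⟩⟩⟩
  rintro ⟨d', hd', hdesc, he⟩
  rcases (SimpleGraph.dart_edge_eq_iff _ _).1 he with rfl | rfl
  · exact hdesc
  · have := colour_snd c d
    rw [hd] at this
    exact absurd (hd'.symm.trans this) (by decide)

/-- Every perfect matching is encoded by a closed set of inner faces: the set of the faces that are
separated from the outer face by the symmetric difference with the matching encoded by `∅`. -/
theorem exists_set_encoding (hG : G.IsTwoConnected) (hout : P.IsOuterplane)
    (c : G.Coloring Colour) (M : G.PerfectMatching) :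
    ∃ S : Set P.InnerFace, ArcClosed (P.DualArc c) S ∧ P.Encodes c M S := by
  obtain ⟨M₀, hM₀⟩ := exists_matching_encoded (P := P) (c := c) (S := ∅) hG hout
    (fun _ _ _ h => h.elim)
  have hM₀' : ∀ d : G.Dart, c d.fst = Colour.white →
      (d.edge ∈ M₀.edges ↔ P.faceOf d = P.outerFace) := by
    intro d hd
    rw [hM₀ d hd]
    constructor
    · intro h
      by_contra hne
      exact h.1 ⟨hne, fun h => h⟩
    · intro h
      exact ⟨fun h' => h'.1 h, fun h' => h'.2⟩
  obtain ⟨x, hxo, hx⟩ := P.exists_face_potential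
    ((fun e => if e ∈ M.edges then 1 else 0) + fun e => if e ∈ M₀.edges then 1 else 0)
    fun v => by
      rw [SimpleGraph.edgeBoundary_add, M.edgeBoundary_eq_one, M₀.edgeBoundary_eq_one]
      decide
  replace hx : ∀ d : G.Dart, c d.fst = Colour.white →
      ((if d.edge ∈ M.edges then 1 else 0) + if P.faceOf d = P.outerFace then 1 else 0) =
        x (P.faceOf d) + x (P.faceOf d.symm) := by
    intro d hd
    rw [← hx, Pi.add_apply]
    simp only [hM₀' d hd]
  -- turning around a white vertex from the outer face, `x` jumps to `1` at the first dart, unless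
  -- this one belongs to `M`, and keeps this value up to the dart that belongs to `M`
  have hright : ∀ d : G.Dart, c d.fst = Colour.white → P.faceOf d ≠ P.outerFace →
      d.edge ∈ M.edges → x (P.faceOf d) = 1 := by
    intro d hd hdo hdM
    obtain ⟨a, hav, hao⟩ := hout.exists_dart d.fst
    have had : a ≠ d := by
      rintro rfl
      exact hdo hao
    refine P.rot_induction hav had (fun d => x (P.faceOf d) = 1) ?_ ?_
    · have := hx a (hav ▸ hd)
      rw [if_neg fun h => had (M.dart_ext hav h hdM), if_pos hao, hao, hxo] at this
      rw [faceOf_rot]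
      simpa using this.symm
    · intro d' hv h1 h2 _ h3
      have := hx d' (hv ▸ hd)
      rw [if_neg fun h => h2 (M.dart_ext hv h hdM),
        if_neg fun h => h1 (P.dart_ext hG (hv.trans hav.symm) (h.trans hao.symm)), h3] at this
      rw [faceOf_rot]
      revert this
      generalize x (P.faceOf d'.symm) = y
      revert y
      decide
  let S : Set P.InnerFace := {s | x s.1 = 1}
  have hSmem : ∀ f, f ∈ P.faceSet S ↔ x f = 1 := by
    intro f
    refine ⟨fun ⟨_, h⟩ => h, fun h => ⟨?_, h⟩⟩
    rintro rfl
    rw [hxo] at h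
    exact absurd h (by decide)
  refine ⟨S, ?_, fun d hd => ?_⟩
  · rintro a b ⟨d, hd, ha, hb⟩ hbS
    change x b.1 = 1 at hbS
    change x a.1 = 1
    by_cases hdM : d.edge ∈ M.edges
    · rw [← ha]
      exact hright d hd (ha ▸ a.2) hdM
    · have := hx d hd
      rw [if_neg hdM, if_neg (ha ▸ a.2), ha, hb, hbS, zero_add, eq_comm,
        CharTwo.add_eq_zero] at this
      exact this
  · rw [Descends, mem_faceSet_compl, hSmem, hSmem]
    have h1 := hx d hd
    have h2 := hright d hd
    by_cases hdM : d.edge ∈ M.edges <;> by_cases hdo : P.faceOf d = P.outerFace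
    · rw [if_pos hdM, if_pos hdo, hdo, hxo] at h1
      simp only [hdM, hdo, ne_eq, not_true_eq_false, false_and, not_false_eq_true, true_and,
        true_iff]
      revert h1
      generalize x (P.faceOf d.symm) = y
      revert y
      decide
    · rw [if_pos hdM, if_neg hdo, h2 hdo hdM] at h1
      simp only [hdM, hdo, h2 hdo hdM, ne_eq, not_true_eq_false, and_false, not_false_eq_true,
        true_and, true_iff]
      revert h1
      generalize x (P.faceOf d.symm) = y
      revert y
      decide
    · rw [if_neg hdM, if_pos hdo, hdo, hxo] at h1
      simp only [hdM, hdo, ne_eq, not_true_eq_false, false_and, not_false_eq_true, true_and,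
        false_iff, not_not]
      revert h1
      generalize x (P.faceOf d.symm) = y
      revert y
      decide
    · rw [if_neg hdM, if_neg hdo] at h1
      simp only [hdM, hdo, ne_eq, not_false_eq_true, true_and, false_iff, not_and, not_not]
      revert h1
      generalize x (P.faceOf d.symm) = y
      generalize x (P.faceOf d) = y'
      revert y y'
      decide

section

variable {c : G.Coloring Colour} {M N : G.PerfectMatching} {S T : Set P.InnerFace}

theorem hasLabel_iff
    (hS : ArcClosed (P.DualArc c) S) (hMS : P.Encodes c M S) (hT : ArcClosed (P.DualArc c) T)
    (hNT : P.Encodes c N T) (hG : G.IsTwoConnected) (s : P.InnerFace) :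
    P.HasLabel M N s ↔ symmDiff S T = {s} := by
  have hs : ∀ d : G.Dart, d.edge ∈ P.faceEdges s.1 ↔
      ¬ (P.faceOf d ∈ P.faceSet {s} ↔ P.faceOf d.symm ∈ P.faceSet {s}) := by
    intro d
    have hmem : ∀ f, f ∈ P.faceSet {s} ↔ f = s.1 := by
      intro f
      constructor
      · rintro ⟨_, h⟩
        exact congrArg Subtype.val h
      · rintro rfl
        exact mem_faceSet.2 rfl
    rw [P.edge_mem_faceEdges, hmem, hmem]
    have := P.faceOf_ne_faceOf_symm hG d
    constructor
    · rintro (h | h)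
      · rw [h] at this
        simp [h, this.symm]
      · rw [h] at this
        simp [h, this]
    · tauto
  have hdiff := mem_symmDiff_edges_iff hS hMS hT hNT
  constructor
  · intro h
    refine eq_of_border_eq fun d => ?_
    rw [← not_iff_not, ← hdiff, ← hs, h]
  · intro h
    rw [h] at hdiff
    have hsub : ∀ e, e ∈ symmDiff M.edges N.edges ∨ e ∈ P.faceEdges s.1 →
        ∃ d : G.Dart, d.edge = e := by
      rintro e ((⟨he, -⟩ | ⟨he, -⟩) | ⟨d, -, hd⟩)
      · exact faceCoboundary.exists_dart ⟨e, M.1.edgeSet_subset he⟩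
      · exact faceCoboundary.exists_dart ⟨e, N.1.edgeSet_subset he⟩
      · exact ⟨d, hd⟩
    rw [HasLabel]
    ext e
    constructor
    · intro he
      obtain ⟨d, rfl⟩ := hsub e (Or.inl he)
      rwa [hs, ← hdiff]
    · intro he
      obtain ⟨d, rfl⟩ := hsub e (Or.inr he)
      rwa [hdiff, ← hs]

/-- An edge of the resonance graph is directed towards the matching whose set is smaller. -/
theorem isProper_iff
    (hS : ArcClosed (P.DualArc c) S) (hMS : P.Encodes c M S) (hT : ArcClosed (P.DualArc c) T)
    (hNT : P.Encodes c N T) (hG : G.IsTwoConnected) {s : P.InnerFace} (h : P.HasLabel M N s) :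
    P.IsProper c M s ↔ s ∈ S := by
  have hST := (hasLabel_iff hS hMS hT hNT hG s).1 h
  have hwhite : ∀ d : G.Dart, P.faceOf d = s.1 → c d.fst = Colour.white →
      (d.edge ∈ M.edges ↔ s ∈ S) := by
    intro d hd hw
    have hM : d.edge ∈ M.edges → s ∈ S := by
      intro hdM
      by_contra hns
      refine ((hMS d hw).1 hdM).1 ?_
      rw [hd]
      exact mem_faceSet.2 hns
    refine ⟨hM, fun hs => ?_⟩
    have hsT : s ∉ T := by
      have : s ∈ symmDiff S T := hST ▸ rfl
      rcases this with h' | h'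
      · exact h'.2
      · exact absurd hs h'.2
    have hdN : d.edge ∉ N.edges := by
      intro hdN
      refine ((hNT d hw).1 hdN).1 ?_
      rw [hd]
      exact mem_faceSet.2 hsT
    have : d.edge ∈ symmDiff M.edges N.edges := by
      rw [show symmDiff M.edges N.edges = _ from h]
      exact ⟨d, hd, rfl⟩
    rcases this with h' | h'
    · exact h'.1
    · exact absurd h'.1 hdN
  constructor
  · rintro ⟨hres, hprop⟩
    obtain ⟨d, hd⟩ := P.exists_faceOf_eq s.1
    by_cases hdM : d.edge ∈ M.edges
    · exact (hwhite d hd (hprop d hd hdM).1).1 hdM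
    · have hn : (P.next d).edge ∈ M.edges := by
        by_contra hn
        exact hdM ((hres d hd).2 hn)
      have hf : P.faceOf (P.next d) = s.1 := by rw [faceOf_next, hd]
      exact (hwhite _ hf (hprop _ hf hn).1).1 hn
  · intro hs
    have hblack : ∀ d : G.Dart, P.faceOf d = s.1 → c d.fst ≠ Colour.white →
        d.edge ∉ M.edges := by
      intro d hd hb hdM
      have hw := (white_or_symm_white c d).resolve_left hb
      rw [← d.edge_symm, hMS _ hw] at hdM
      refine hdM.2 ?_
      rw [SimpleGraph.Dart.symm_symm, hd]
      exact mem_faceSet.2 hs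
    have hiff : ∀ d : G.Dart, P.faceOf d = s.1 → (d.edge ∈ M.edges ↔ c d.fst = Colour.white) := by
      intro d hd
      by_cases hw : c d.fst = Colour.white
      · simp only [hwhite d hd hw, hs, hw]
      · simp only [hblack d hd hw, hw]
    refine ⟨fun d hd => ?_, fun d hd hdM => ?_⟩
    · rw [hiff d hd, hiff _ ((P.faceOf_next d).trans hd), next_fst, colour_snd]
      cases c d.fst <;> simp
    · have hw := (hiff d hd).1 hdM
      refine ⟨hw, ?_⟩
      rw [colour_snd, hw]
      rfl

end

variable (P) in
/-- Perfect matchings correspond to the closed sets of inner faces. -/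
theorem exists_encoding (hG : G.IsTwoConnected) (hout : P.IsOuterplane) (c : G.Coloring Colour) :
    ∃ Φ : G.PerfectMatching ≃ {S : Set P.InnerFace // ArcClosed (P.DualArc c) S},
      ∀ M, P.Encodes c M (Φ M).1 := by
  choose f hf hf' using exists_set_encoding (P := P) hG hout c
  refine ⟨Equiv.ofBijective (fun M => ⟨f M, hf M⟩) ⟨fun M N h => ?_, fun S => ?_⟩, hf'⟩
  · have hMN : f M = f N := congrArg Subtype.val h
    refine SimpleGraph.PerfectMatching.ext_edges ?_
    rw [← symmDiff_eq_bot]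
    ext e
    refine ⟨fun he => ?_, fun he => he.elim⟩
    obtain ⟨d, rfl⟩ : ∃ d : G.Dart, d.edge = e := by
      rcases he with he | he
      · exact faceCoboundary.exists_dart ⟨e, M.1.edgeSet_subset he.1⟩
      · exact faceCoboundary.exists_dart ⟨e, N.1.edgeSet_subset he.1⟩
    rw [mem_symmDiff_edges_iff (hf M) (hf' M) (hf N) (hf' N), hMN, symmDiff_self] at he
    exact he ⟨fun h => h.2.elim, fun h => h.2.elim⟩
  · obtain ⟨M, hM⟩ := exists_matching_encoded hG hout S.2
    refine ⟨M, Subtype.ext ?_⟩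
    change f M = S.1
    rw [← symmDiff_eq_bot]
    refine eq_of_border_eq fun d => ?_
    rw [← not_iff_not, ← mem_symmDiff_edges_iff (hf M) (hf' M) S.2 hM, symmDiff_self]
    refine ⟨fun h => h.elim, fun h => (h ⟨fun h => h.2.elim, fun h => h.2.elim⟩).elim⟩

end PlaneEmbedding

end Encoding

/-! ### Closed sets of an oriented tree -/

section OrientedTree

variable {F F' : Type*} {A : F → F → Prop} {A' : F' → F' → Prop}

/-- The relation `A` is an orientation of a tree: the two ends of every arc are separated by a set
which no other arc enters or leaves, and the underlying graph is connected. -/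
structure IsOrientedTree (A : F → F → Prop) : Prop where
  sep : ∀ a b, A a b → ∃ X : Set F, a ∈ X ∧ b ∉ X ∧
    ∀ c d, A c d → (c ∈ X ↔ d ∈ X) ∨ (c = a ∧ d = b)
  conn : ∀ X : Set F, (∀ a b, A a b → (a ∈ X ↔ b ∈ X)) → ∀ a b, a ∈ X → b ∈ X

/-- The order generated by the arcs: `a` belongs to every closed set which contains `b`. -/
def ArcBelow (A : F → F → Prop) (a b : F) : Prop :=
  ∀ S : Set F, ArcClosed A S → b ∈ S → a ∈ S

theorem arcClosed_empty : ArcClosed A ∅ := fun _ _ _ h => h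

theorem arcClosed_univ : ArcClosed A Set.univ := fun _ _ _ _ => trivial

theorem ArcBelow.trans {a b c : F} (h : ArcBelow A a b) (h' : ArcBelow A b c) : ArcBelow A a c :=
  fun S hS hc => h S hS (h' S hS hc)

theorem arcBelow_refl (a : F) : ArcBelow A a a := fun _ _ h => h

theorem arcBelow_of_arc {a b : F} (h : A a b) : ArcBelow A a b := fun _ hS => hS _ _ h

theorem arcClosed_below (b : F) : ArcClosed A {a | ArcBelow A a b} :=
  fun _ _ h h' => (arcBelow_of_arc h).trans h'

theorem arcBelow_iff {a b : F} : ArcBelow A a b ↔ Relation.ReflTransGen A a b := by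
  constructor
  · intro h
    exact h {x | Relation.ReflTransGen A x b} (fun _ _ h h' => h'.head h) Relation.ReflTransGen.refl
  · intro h
    induction h with
    | refl => exact arcBelow_refl a
    | tail _ h ih => exact ih.trans (arcBelow_of_arc h)

namespace IsOrientedTree

theorem not_arcBelow (hA : IsOrientedTree A) {a b : F} (h : A a b) : ¬ ArcBelow A b a := by
  obtain ⟨X, ha, hb, hX⟩ := hA.sep a b h
  intro hba
  refine hb (hba X (fun c d hcd hd => ?_) ha)
  rcases hX c d hcd with h' | ⟨-, rfl⟩
  · exact h'.2 hd
  · exact absurd hd hb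

theorem ne (hA : IsOrientedTree A) {a b : F} (h : A a b) : a ≠ b := by
  rintro rfl
  exact hA.not_arcBelow h (arcBelow_refl a)

theorem antisymm (hA : IsOrientedTree A) {a b : F} (h : ArcBelow A a b) (h' : ArcBelow A b a) :
    a = b := by
  rcases Relation.ReflTransGen.cases_head (arcBelow_iff.1 h) with rfl | ⟨c, hac, hcb⟩
  · rfl
  · exact absurd ((arcBelow_iff.2 hcb).trans h') (hA.not_arcBelow hac)

/-- The arcs are the covering pairs of the order which they generate. -/
theorem arc_iff (hA : IsOrientedTree A) {a b : F} :
    A a b ↔ a ≠ b ∧ ArcBelow A a b ∧ ∀ c, ArcBelow A a c → ArcBelow A c b → c = a ∨ c = b := by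
  constructor
  · intro h
    refine ⟨hA.ne h, arcBelow_of_arc h, fun c hac hcb => ?_⟩
    obtain ⟨X, ha, hb, hX⟩ := hA.sep a b h
    by_cases hc : c ∈ X
    · refine Or.inl (hA.antisymm (fun S hS haS => ?_) hac)
      have hclosed : ArcClosed A (S ∪ Xᶜ) := by
        rintro x y hxy (hy | hy)
        · exact Or.inl (hS _ _ hxy hy)
        · rcases hX x y hxy with h' | ⟨rfl, -⟩
          · exact Or.inr fun hx => hy (h'.1 hx)
          · exact Or.inl haS
      exact (hcb _ hclosed (Or.inr hb)).resolve_right fun h => h hc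
    · refine Or.inr (hA.antisymm hcb fun S hS hcS => ?_)
      by_contra hbS
      have hclosed : ArcClosed A (S \ X) := by
        rintro x y hxy ⟨hy, hyX⟩
        refine ⟨hS _ _ hxy hy, fun hx => ?_⟩
        rcases hX x y hxy with h' | ⟨-, rfl⟩
        · exact hyX (h'.1 hx)
        · exact hbS hy
      exact (hac _ hclosed ⟨hcS, hc⟩).2 ha
  · rintro ⟨hne, hab, hcov⟩
    rcases Relation.ReflTransGen.cases_tail (arcBelow_iff.1 hab) with rfl | ⟨c, hac, hcb⟩
    · exact absurd rfl hne
    · rcases hcov c (arcBelow_iff.2 hac) (arcBelow_of_arc hcb) with rfl | rfl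
      · exact hcb
      · exact absurd rfl (hA.ne hcb)

/-- A closed set can be reduced to a smaller closed set one element at a time. -/
theorem exists_arcClosed_diff_singleton [Finite F] (hA : IsOrientedTree A) {S B : Set F}
    (hS : ArcClosed A S) (hB : ArcClosed A B) (h : (S \ B).Nonempty) :
    ∃ t ∈ S \ B, ArcClosed A (S \ {t}) := by
  let r : F → F → Prop := fun x y => x ≠ y ∧ ArcBelow A y x
  have : IsTrans F r := ⟨fun x y z hxy hyz => ⟨by
    rintro rfl
    exact hxy.1 (hA.antisymm hyz.2 hxy.2), hyz.2.trans hxy.2⟩⟩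
  have : Std.Irrefl r := ⟨fun x h => h.1 rfl⟩
  obtain ⟨t, ht, hmin⟩ := (Finite.wellFounded_of_trans_of_irrefl r).has_min _ h
  refine ⟨t, ht, fun a b hab hb => ⟨hS a b hab hb.1, ?_⟩⟩
  rintro rfl
  exact hmin b ⟨hb.1, fun h => ht.2 (hB _ _ hab h)⟩ ⟨hb.2, arcBelow_of_arc hab⟩

theorem arcClosed_strictlyBelow (hA : IsOrientedTree A) (s : F) :
    ArcClosed A ({a | ArcBelow A a s} \ {s}) := by
  rintro a b hab ⟨hb, -⟩
  refine ⟨(arcBelow_of_arc hab).trans hb, ?_⟩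
  rintro rfl
  exact hA.not_arcBelow hab hb

end IsOrientedTree

theorem symmDiff_insert_self {S : Set F} {s : F} (h : s ∉ S) : symmDiff S (insert s S) = {s} := by
  ext x
  simp only [Set.mem_symmDiff, Set.mem_insert_iff, Set.mem_singleton_iff]
  constructor
  · rintro (⟨h1, h2⟩ | ⟨h1 | h1, h2⟩)
    · exact absurd (Or.inr h1) h2
    · exact h1
    · exact absurd h1 h2
  · rintro rfl
    exact Or.inr ⟨Or.inl rfl, h⟩

/-- Opposite sides of a square in a hypercube have the same direction. -/
theorem eq_of_square {S₀ S₁ S₂ S₃ : Set F} {a b c d : F} (h₀₁ : symmDiff S₀ S₁ = {a})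
    (h₁₂ : symmDiff S₁ S₂ = {b}) (h₂₃ : symmDiff S₂ S₃ = {c}) (h₃₀ : symmDiff S₃ S₀ = {d})
    (h₀₂ : S₀ ≠ S₂) (h₁₃ : S₁ ≠ S₃) : a = c := by
  have hab : a ≠ b := by
    rintro rfl
    rw [symmDiff_comm] at h₀₁
    exact h₀₂ (symmDiff_right_injective S₁ (h₀₁.trans h₁₂.symm))
  have had : a ≠ d := by
    rintro rfl
    rw [symmDiff_comm] at h₃₀
    exact h₁₃ (symmDiff_right_injective S₀ (h₀₁.trans h₃₀.symm))
  have e₀₁ : a ∈ S₀ ↔ a ∉ S₁ := by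
    have : a ∈ symmDiff S₀ S₁ := h₀₁ ▸ rfl
    rw [Set.mem_symmDiff] at this
    tauto
  have e : ∀ {S T : Set F} {b : F}, symmDiff S T = {b} → a ≠ b → (a ∈ S ↔ a ∈ T) := by
    intro S T b h hne
    have : a ∉ symmDiff S T := h ▸ hne
    rw [Set.mem_symmDiff] at this
    tauto
  by_contra hac
  have e₁₂ := e h₁₂ hab
  have e₂₃ := e h₂₃ hac
  have e₃₀ := e h₃₀ had
  tauto

/-- Every element can be added to some closed set. -/
theorem IsOrientedTree.exists_symmDiff_eq (hA : IsOrientedTree A) (s : F) :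
    ∃ S T : {S : Set F // ArcClosed A S}, symmDiff S.1 T.1 = {s} := by
  refine ⟨⟨_, hA.arcClosed_strictlyBelow s⟩, ⟨_, arcClosed_below s⟩, ?_⟩
  have := symmDiff_insert_self (show s ∉ {a | ArcBelow A a s} \ {s} from fun h => h.2 rfl)
  rwa [Set.insert_sdiff_singleton, Set.insert_eq_of_mem (a := s) (s := {a | ArcBelow A a s})
    (arcBelow_refl s)] at this

section ClosedSetIso

variable (φ : {S : Set F // ArcClosed A S} ≃ {S : Set F' // ArcClosed A' S})

/-- An adjacency preserving bijection between the closed sets maps steps in the same direction to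
steps in the same direction: any such step can be moved, through a series of squares, to the one
from the set of the elements strictly below `s`. -/
theorem IsOrientedTree.exists_label [Finite F] (hA : IsOrientedTree A)
    (hφ : ∀ S T, (∃ s, symmDiff S.1 T.1 = {s}) → ∃ s', symmDiff (φ S).1 (φ T).1 = {s'}) (s : F) :
    ∃ s', ∀ S T, symmDiff S.1 T.1 = {s} → symmDiff (φ S).1 (φ T).1 = {s'} := by
  have hbot : insert s ({a | ArcBelow A a s} \ {s}) = {a | ArcBelow A a s} := by
    rw [Set.insert_sdiff_singleton]
    exact Set.insert_eq_of_mem (arcBelow_refl s)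
  have hns : s ∉ {a | ArcBelow A a s} \ {s} := fun h => h.2 rfl
  obtain ⟨s', hs'⟩ := hφ ⟨_, hA.arcClosed_strictlyBelow s⟩ ⟨_, arcClosed_below s⟩
    ⟨s, by
      have := symmDiff_insert_self hns
      rwa [hbot] at this⟩
  have key : ∀ (n : ℕ) (S T : {S : Set F // ArcClosed A S}), s ∉ S.1 → T.1 = insert s S.1 →
      (S.1 \ ({a | ArcBelow A a s} \ {s})).ncard = n → symmDiff (φ S).1 (φ T).1 = {s'} := by
    intro n
    induction n with
    | zero =>
      rintro ⟨S, hS⟩ ⟨T, hT⟩ hsS hTS hn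
      change T = _ at hTS
      subst hTS
      have h1 : S = {a | ArcBelow A a s} \ {s} := by
        apply Set.Subset.antisymm
        · rwa [Set.ncard_eq_zero, Set.sdiff_eq_empty] at hn
        · rintro a ⟨ha, hne⟩
          exact (ha _ hT (Or.inl rfl)).resolve_left hne
      subst h1
      simp only [hbot]
      exact hs'
    | succ n ih =>
      rintro ⟨S, hS⟩ ⟨T, hT⟩ hsS hTS hn
      change T = _ at hTS
      subst hTS
      obtain ⟨t, ht, hSt⟩ := hA.exists_arcClosed_diff_singleton hS (hA.arcClosed_strictlyBelow s)
        (Set.nonempty_of_ncard_ne_zero (by rw [hn]; exact n.succ_ne_zero))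
      have hst : s ≠ t := by
        rintro rfl
        exact hsS ht.1
      have hTt : ArcClosed A (insert s (S \ {t})) := by
        rintro a b hab (rfl | hb)
        · refine Or.inr ⟨(hT _ _ hab (Or.inl rfl)).resolve_left (hA.ne hab), ?_⟩
          rintro rfl
          exact ht.2 ⟨arcBelow_of_arc hab, hA.ne hab⟩
        · exact Or.inr (hSt _ _ hab hb)
      have hins : insert t (S \ {t}) = S := by
        rw [Set.insert_sdiff_singleton, Set.insert_eq_of_mem ht.1]
      have hins' : insert t (insert s (S \ {t})) = insert s S := by
        rw [Set.insert_comm, hins]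
      have hsSt : s ∉ S \ {t} := fun h => hsS h.1
      have htSt : t ∉ S \ {t} := fun h => h.2 rfl
      have htTt : t ∉ insert s (S \ {t}) := by
        rintro (h | h)
        · exact hst h.symm
        · exact htSt h
      have ih' := ih ⟨_, hSt⟩ ⟨_, hTt⟩ hsSt rfl (by
        have : (S \ {t}) \ ({a | ArcBelow A a s} \ {s}) =
            (S \ ({a | ArcBelow A a s} \ {s})) \ {t} := Set.sdiff_sdiff_comm
        rw [this, Set.ncard_sdiff_singleton_of_mem ht, hn]
        rfl)
      obtain ⟨a, ha⟩ := hφ ⟨S, hS⟩ ⟨_, hT⟩ ⟨s, symmDiff_insert_self hsS⟩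
      obtain ⟨b, hb⟩ := hφ ⟨_, hT⟩ ⟨_, hTt⟩ ⟨t, by
        have := symmDiff_insert_self htTt
        rwa [hins', symmDiff_comm] at this⟩
      obtain ⟨d, hd⟩ := hφ ⟨_, hSt⟩ ⟨S, hS⟩ ⟨t, by
        have := symmDiff_insert_self htSt
        rwa [hins] at this⟩
      rw [symmDiff_comm] at ih'
      have hac := eq_of_square ha hb ih' hd (fun h => by
          have h2 := congrArg Subtype.val (φ.injective (Subtype.ext h))
          exact hsS ((show S = insert s (S \ {t}) from h2).symm.subset (Or.inl rfl)))
        (fun h => by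
          have h2 := congrArg Subtype.val (φ.injective (Subtype.ext h))
          exact hsSt ((show insert s S = S \ {t} from h2).subset (Or.inl rfl)))
      rw [ha, hac]
  have hcase : ∀ {S T : Set F}, symmDiff S T = {s} → s ∉ S → T = insert s S := by
    intro S T h hs
    exact symmDiff_right_injective S (h.trans (symmDiff_insert_self hs).symm)
  refine ⟨s', fun S T h => ?_⟩
  by_cases hs : s ∈ S.1
  · have hsT : s ∉ T.1 := by
      have : s ∈ symmDiff S.1 T.1 := h ▸ rfl
      rw [Set.mem_symmDiff] at this
      tauto
    rw [symmDiff_comm] at h ⊢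
    exact key _ T S hsT (hcase h hsT) rfl
  · exact key _ S T hs (hcase h hs) rfl

/-- An isomorphism between the graphs of closed sets of two oriented trees is induced by a
bijection of the trees, which preserves all arcs or reverses all arcs. -/
theorem IsOrientedTree.exists_equiv_of_closedSetIso [Finite F] [Finite F']
    (hA : IsOrientedTree A) (hA' : IsOrientedTree A')
    (hφ : ∀ S T, (∃ s, symmDiff S.1 T.1 = {s}) ↔ ∃ s', symmDiff (φ S).1 (φ T).1 = {s'}) :
    ∃ ψ : F ≃ F', (∀ S T s, symmDiff S.1 T.1 = {s} → symmDiff (φ S).1 (φ T).1 = {ψ s}) ∧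
      ((∀ a b, A' (ψ a) (ψ b) ↔ A a b) ∧ (∀ S s, ψ s ∈ (φ S).1 ↔ s ∈ S.1) ∨
        (∀ a b, A' (ψ a) (ψ b) ↔ A b a) ∧ (∀ S s, ψ s ∈ (φ S).1 ↔ s ∉ S.1)) := by
  have hφ' : ∀ S T, (∃ s, symmDiff S.1 T.1 = {s}) →
      ∃ s', symmDiff (φ.symm S).1 (φ.symm T).1 = {s'} := by
    intro S T h
    rw [hφ, Equiv.apply_symm_apply, Equiv.apply_symm_apply]
    exact h
  choose f hf using hA.exists_label φ fun S T => (hφ S T).1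
  choose g hg using hA'.exists_label φ.symm hφ'
  let ψ : F ≃ F' :=
    { toFun := f
      invFun := g
      left_inv := fun s => by
        obtain ⟨S, T, h⟩ := hA.exists_symmDiff_eq s
        have := hg _ _ _ (hf _ _ _ h)
        rw [Equiv.symm_apply_apply, Equiv.symm_apply_apply, h] at this
        exact (Set.singleton_injective this).symm
      right_inv := fun s => by
        obtain ⟨S, T, h⟩ := hA'.exists_symmDiff_eq s
        have := hf _ _ _ (hg _ _ _ h)
        rw [Equiv.apply_symm_apply, Equiv.apply_symm_apply, h] at this
        exact (Set.singleton_injective this).symm }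
  have hψ : ∀ S T s, symmDiff S.1 T.1 = {s} → symmDiff (φ S).1 (φ T).1 = {ψ s} :=
    fun S T s => hf s S T
  -- up to `ψ`, the map `φ` is the translation by the image of the empty set
  let B : Set F := {s | ψ s ∈ (φ ⟨∅, arcClosed_empty⟩).1}
  have hB : ∀ (n : ℕ) (S : {S : Set F // ArcClosed A S}), S.1.ncard = n →
      ∀ s, ψ s ∈ (φ S).1 ↔ ¬ (s ∈ S.1 ↔ s ∈ B) := by
    intro n
    induction n with
    | zero =>
      rintro ⟨S, hS⟩ hn s
      change S.ncard = 0 at hn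
      rw [Set.ncard_eq_zero] at hn
      subst hn
      simp [B]
    | succ n ih =>
      rintro ⟨S, hS⟩ hn s
      change S.ncard = n + 1 at hn
      obtain ⟨t, ⟨ht, -⟩, hSt⟩ := hA.exists_arcClosed_diff_singleton hS arcClosed_empty
        (by
          rw [Set.sdiff_empty]
          exact Set.nonempty_of_ncard_ne_zero (by omega))
      have h1 := ih ⟨_, hSt⟩ (by
        change (S \ {t}).ncard = n
        rw [Set.ncard_sdiff_singleton_of_mem ht, hn]
        rfl) s
      have h2 : symmDiff (S \ {t}) S = {t} := by
        have := symmDiff_insert_self (show t ∉ S \ {t} from fun h => h.2 rfl)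
        rwa [Set.insert_sdiff_singleton, Set.insert_eq_of_mem ht] at this
      have h3 := hψ ⟨_, hSt⟩ ⟨S, hS⟩ t h2
      have h4 : ψ s ∈ symmDiff (φ ⟨_, hSt⟩).1 (φ ⟨S, hS⟩).1 ↔ s = t := by
        rw [h3, Set.mem_singleton_iff, ψ.injective.eq_iff]
      rw [Set.mem_symmDiff] at h4
      have h5 : s ∈ S \ {t} ↔ s ∈ S ∧ s ≠ t := Iff.rfl
      change ψ s ∈ (φ ⟨_, hSt⟩).1 ↔ ¬ (s ∈ S \ {t} ↔ s ∈ B) at h1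
      rw [h5] at h1
      change _ ↔ ¬ (s ∈ S ↔ s ∈ B)
      by_cases hst : s = t
      · subst hst
        tauto
      · tauto
  replace hB := fun S s => hB _ S rfl s
  -- otherwise the image of `φ` would miss the empty set or the whole tree
  have harc : ∀ a b, A a b → (a ∈ B ↔ b ∈ B) := by
    intro a b hab
    obtain ⟨S, hS⟩ := φ.surjective ⟨∅, arcClosed_empty⟩
    obtain ⟨T, hT⟩ := φ.surjective ⟨Set.univ, arcClosed_univ⟩
    have h1 : ∀ s, ¬ ¬ (s ∈ S.1 ↔ s ∈ B) := by
      intro s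
      rw [← hB S s, hS]
      exact fun h => h
    have h2 : ∀ s, ¬ (s ∈ T.1 ↔ s ∈ B) := by
      intro s
      rw [← hB T s, hT]
      trivial
    have h3 := S.2 _ _ hab
    have h4 := T.2 _ _ hab
    have h5 := h1 a
    have h6 := h1 b
    have h7 := h2 a
    have h8 := h2 b
    tauto
  have hconst := hA.conn B harc
  have hsurj : ∀ S' : Set F', ArcClosed A' S' →
      ∃ S : {S : Set F // ArcClosed A S}, (φ S).1 = S' := by
    intro S' h
    obtain ⟨S, hS⟩ := φ.surjective ⟨S', h⟩
    exact ⟨S, by rw [hS]⟩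
  refine ⟨ψ, hψ, ?_⟩
  by_cases hne : B.Nonempty
  · right
    obtain ⟨a₀, ha₀⟩ := hne
    have hmem : ∀ S s, ψ s ∈ (φ S).1 ↔ s ∉ S.1 := by
      intro S s
      have := hconst a₀ s ha₀
      rw [hB]
      tauto
    have hbelow : ∀ a b, ArcBelow A' (ψ a) (ψ b) ↔ ArcBelow A b a := by
      intro a b
      constructor
      · intro h S hS ha
        by_contra hb
        exact (hmem ⟨S, hS⟩ a).1 (h _ (φ ⟨S, hS⟩).2 ((hmem ⟨S, hS⟩ b).2 hb)) ha
      · intro h S' hS' hb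
        obtain ⟨S, rfl⟩ := hsurj S' hS'
        rw [hmem] at hb ⊢
        exact fun ha => hb (h _ S.2 ha)
    refine ⟨fun a b => ?_, hmem⟩
    rw [hA.arc_iff, hA'.arc_iff, hbelow, ψ.injective.ne_iff, ne_comm]
    refine and_congr_right fun _ => and_congr_right fun _ => ?_
    rw [← ψ.forall_congr_right]
    simp only [hbelow, ψ.injective.eq_iff]
    exact forall_congr' fun c => ⟨fun h h1 h2 => (h h2 h1).symm, fun h h1 h2 => (h h2 h1).symm⟩
  · left
    have hmem : ∀ S s, ψ s ∈ (φ S).1 ↔ s ∈ S.1 := by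
      intro S s
      have : s ∉ B := fun h => hne ⟨s, h⟩
      rw [hB]
      tauto
    have hbelow : ∀ a b, ArcBelow A' (ψ a) (ψ b) ↔ ArcBelow A a b := by
      intro a b
      constructor
      · intro h S hS hb
        exact (hmem ⟨S, hS⟩ a).1 (h _ (φ ⟨S, hS⟩).2 ((hmem ⟨S, hS⟩ b).2 hb))
      · intro h S' hS' hb
        obtain ⟨S, rfl⟩ := hsurj S' hS'
        rw [hmem] at hb ⊢
        exact h _ S.2 hb
    refine ⟨fun a b => ?_, hmem⟩
    rw [hA.arc_iff, hA'.arc_iff, hbelow, ψ.injective.ne_iff]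
    refine and_congr_right fun _ => and_congr_right fun _ => ?_
    rw [← ψ.forall_congr_right]
    simp only [hbelow, ψ.injective.eq_iff]

end ClosedSetIso

end OrientedTree

namespace PlaneEmbedding

variable {V : Type*} [Fintype V] {G : SimpleGraph V} (P : PlaneEmbedding G)

theorem isOrientedTree (hG : G.IsTwoConnected) (hout : P.IsOuterplane) (c : G.Coloring Colour) :
    IsOrientedTree (P.DualArc c) where
  sep := by
    rintro a b ⟨e, he, ha, hb⟩
    obtain ⟨X, h1, h2, hX⟩ := P.exists_separation hout e (ha ▸ a.2) (hb ▸ b.2)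
    rw [ha] at h1
    rw [hb] at h2
    refine ⟨{s | s.1 ∈ X}, h1, h2, ?_⟩
    rintro s t ⟨d, hd, hs, ht⟩
    by_cases hde : d = e
    · subst hde
      exact Or.inr ⟨Subtype.ext (hs.symm.trans ha), Subtype.ext (ht.symm.trans hb)⟩
    · left
      have := hX d (hs ▸ s.2) (ht ▸ t.2) hde (by
        rintro rfl
        have := colour_snd c e
        rw [he] at this
        exact absurd (hd.symm.trans this) (by decide))
      rwa [hs, ht] at this
  conn := by
    intro X hX a b ha
    have := P.mem_iff_mem_of_chord hG (P.faceSet X) (fun d h h' => by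
      rcases white_or_symm_white c d with hw | hw
      · have := hX ⟨_, h⟩ ⟨_, h'⟩ ⟨d, hw, rfl, rfl⟩
        exact ⟨fun hm => ⟨h', this.1 hm.2⟩, fun hm => ⟨h, this.2 hm.2⟩⟩
      · have := hX ⟨_, h'⟩ ⟨_, h⟩ ⟨d.symm, hw, rfl, by rw [SimpleGraph.Dart.symm_symm]⟩
        exact ⟨fun hm => ⟨h', this.2 hm.2⟩, fun hm => ⟨h, this.1 hm.2⟩⟩) a b
    rw [mem_faceSet, mem_faceSet] at this
    exact this.1 ha

end PlaneEmbedding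

/-! ### Regions and their exterior -/

namespace PlaneEmbedding

variable {V : Type*} {G : SimpleGraph V} (P : PlaneEmbedding G)

/-- The subgraph of `G` formed by the peripheries of the inner faces in `I`. -/
def region (I : Set P.InnerFace) : G.Subgraph where
  verts := {v | ∃ d : G.Dart, d.fst = v ∧ P.faceOf d ∈ P.faceSet I}
  Adj u v := ∃ d : G.Dart, d.edge = s(u, v) ∧ P.faceOf d ∈ P.faceSet I
  adj_sub := by
    rintro u v ⟨d, hd, -⟩
    have h := d.edge_mem
    rwa [hd, SimpleGraph.mem_edgeSet] at h
  edge_vert := by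
    rintro u v ⟨d, hd, h⟩
    rcases SimpleGraph.dart_edge_eq_mk'_iff'.1 hd with ⟨h1, -⟩ | ⟨-, h2⟩
    · exact ⟨d, h1, h⟩
    · exact ⟨P.next d, by rw [next_fst, h2], by rwa [faceOf_next]⟩
  symm := ⟨by
    rintro u v ⟨d, hd, h⟩
    exact ⟨d, by rw [hd, Sym2.eq_swap], h⟩⟩

variable {P}

theorem edge_mem_region {I : Set P.InnerFace} {d : G.Dart} :
    d.edge ∈ (P.region I).edgeSet ↔
      P.faceOf d ∈ P.faceSet I ∨ P.faceOf d.symm ∈ P.faceSet I := by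
  change (∃ d' : G.Dart, d'.edge = s(d.fst, d.snd) ∧ _) ↔ _
  constructor
  · rintro ⟨d', he, h⟩
    rcases (SimpleGraph.dart_edge_eq_iff d' d).1 he with rfl | rfl
    · exact Or.inl h
    · exact Or.inr h
  · rintro (h | h)
    · exact ⟨d, rfl, h⟩
    · exact ⟨d.symm, d.edge_symm, h⟩

variable (P)

theorem region_singleton (s : P.InnerFace) : P.region {s} = P.periphery s.1 := by
  have hs : ∀ f, f ∈ P.faceSet {s} ↔ f = s.1 := by
    intro f
    constructor
    · rintro ⟨_, h⟩
      exact congrArg Subtype.val h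
    · rintro rfl
      exact mem_faceSet.2 rfl
  refine SimpleGraph.Subgraph.ext ?_ ?_
  · ext v
    rw [P.mem_periphery_verts]
    simp only [region, hs]
    rfl
  · ext u v
    change (∃ d : G.Dart, d.edge = s(u, v) ∧ P.faceOf d ∈ P.faceSet {s}) ↔
      ∃ d : G.Dart, P.faceOf d = s.1 ∧ d.edge = s(u, v)
    simp only [hs, and_comm]

/-- A set of inner faces is connected in the inner dual: there is no way of dividing its elements
into two parts without a common edge. -/
def DualConnected (I : Set P.InnerFace) : Prop :=
  ∀ X : Set P.Face, (∀ d : G.Dart, P.faceOf d ∈ P.faceSet I → P.faceOf d.symm ∈ P.faceSet I →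
    (P.faceOf d ∈ X ↔ P.faceOf d.symm ∈ X)) → ∀ s ∈ I, ∀ t ∈ I, s.1 ∈ X ↔ t.1 ∈ X

variable {P}

theorem notMem_faceSet_of_inExterior {I : Set P.InnerFace} {f : P.Face}
    (h : P.InExterior (P.region I) f) : f ∉ P.faceSet I := by
  induction h with
  | refl => exact outerFace_notMem_faceSet
  | tail _ h _ =>
    obtain ⟨d, hd, -, rfl⟩ := h
    exact fun h' => hd (edge_mem_region.2 (Or.inr h'))

theorem exists_walk_next (k : ℕ) {u v : V} (d : G.Dart) (hu : d.fst = u)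
    (hv : (P.next^[k] d).fst = v) : ∃ p : G.Walk u v, p.darts = List.iterate P.next d k := by
  induction k generalizing d u with
  | zero =>
    subst hu hv
    exact ⟨SimpleGraph.Walk.nil, rfl⟩
  | succ k ih =>
    subst hu
    obtain ⟨p, hp⟩ := ih (P.next d) (P.next_fst d) hv
    exact ⟨SimpleGraph.Walk.cons d.adj p, by rw [SimpleGraph.Walk.darts_cons, hp]; rfl⟩

section

open scoped Classical

variable [Fintype V]

/-- A chord at the border of a connected set of inner faces separates this set from the face on
its other side. -/
theorem DualConnected.exists_separation {I : Set P.InnerFace} (hI : P.DualConnected I)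
    (hout : P.IsOuterplane) {e : G.Dart} (he : P.faceOf e ≠ P.outerFace)
    (he' : P.faceOf e ∉ P.faceSet I) (heI : P.faceOf e.symm ∈ P.faceSet I) :
    ∃ X : Set P.Face, P.faceOf e ∈ X ∧ (∀ f ∈ P.faceSet I, f ∉ X) ∧
      ∀ d : G.Dart, P.faceOf d ≠ P.outerFace → P.faceOf d.symm ≠ P.outerFace → d ≠ e →
        d ≠ e.symm → (P.faceOf d ∈ X ↔ P.faceOf d.symm ∈ X) := by
  obtain ⟨X, h1, h2, hX⟩ := P.exists_separation hout e he heI.1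
  refine ⟨X, h1, fun f hf hfX => h2 ?_, hX⟩
  refine (hI X (fun d hd hd' => hX d hd.1 hd'.1 ?_ ?_) _ hf.2 _ heI.2).1 hfX
  · rintro rfl
    exact he' hd
  · rintro rfl
    rw [SimpleGraph.Dart.symm_symm] at hd'
    exact he' hd'

/-- The exterior of the region of a connected set `I` of inner faces consists of all other faces.
Consider the set `C` of the faces not in `I` that are cut off from the outer face by `I`, and a
chord `e` between `C` and `I`.  The part of `C` beyond `e` would have `e` as its only border edge, but
borders are even sets of edges. -/
theorem inExterior_region_iff {I : Set P.InnerFace} (hI : P.DualConnected I)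
    (hout : P.IsOuterplane) {f : P.Face} :
    P.InExterior (P.region I) f ↔ f ∉ P.faceSet I := by
  refine ⟨notMem_faceSet_of_inExterior, fun hf => ?_⟩
  by_contra hext
  let C : Set P.Face := {g | g ∉ P.faceSet I ∧ ¬ P.InExterior (P.region I) g}
  have hfC : f ∈ C := ⟨hf, hext⟩
  have hoC : P.outerFace ∉ C := fun h => h.2 Relation.ReflTransGen.refl
  have hCo : ∀ g ∈ C, g ≠ P.outerFace := fun g hg h => hoC (h ▸ hg)
  have hborder : ∀ d : G.Dart, P.faceOf d ∈ C → P.faceOf d.symm ∉ C →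
      P.faceOf d.symm ∈ P.faceSet I := by
    intro d hd hd'
    by_contra hI'
    have hx : P.InExterior (P.region I) (P.faceOf d.symm) := by
      by_contra hx
      exact hd' ⟨hI', hx⟩
    refine hd.2 (hx.tail ⟨d.symm, fun h => ?_, rfl, by rw [SimpleGraph.Dart.symm_symm]⟩)
    rw [edge_mem_region, SimpleGraph.Dart.symm_symm] at h
    exact h.elim hI' hd.1
  obtain ⟨e, he, heC⟩ : ∃ e : G.Dart, P.faceOf e ∈ C ∧ P.faceOf e.symm ∉ C := by
    by_contra! h
    have := P.eq_of_forall_faceOf_eq (fun g => g ∈ C) (fun d => propext ⟨h d, fun h' => by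
      have := h d.symm h'
      rwa [SimpleGraph.Dart.symm_symm] at this⟩) f P.outerFace
    exact hoC (this.mp hfC)
  have heI := hborder e he heC
  obtain ⟨X, heX, hIX, hX⟩ := hI.exists_separation hout (hCo _ he) he.1 heI
  -- no dart except `e` leaves the part of `C` beyond `e`
  have hclosed : ∀ d : G.Dart, d ≠ e → P.faceOf d ∈ C ∩ X → P.faceOf d.symm ∈ C ∩ X := by
    rintro d hde ⟨hdC, hdX⟩
    have hde' : d ≠ e.symm := by
      rintro rfl
      exact heC hdC
    have hX' := hX d (hCo _ hdC)
    by_cases hd' : P.faceOf d.symm ∈ C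
    · exact ⟨hd', (hX' (hCo _ hd') hde hde').1 hdX⟩
    · have hdI := hborder d hdC hd'
      exact absurd ((hX' hdI.1 hde hde').1 hdX) (hIX _ hdI)
  have hsum := P.sum_faceOf_add_eq_zero (fun g => if g ∈ C ∩ X then 1 else 0) e.fst
  have hmem : e ∈ Finset.univ.filter fun d : G.Dart => d.fst = e.fst := by simp
  rw [Finset.sum_eq_single_of_mem e hmem, if_pos ⟨he, heX⟩, if_neg fun h => heC h.1] at hsum
  · exact absurd hsum (by decide)
  · intro d hd hne
    have hiff : P.faceOf d ∈ C ∩ X ↔ P.faceOf d.symm ∈ C ∩ X := by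
      refine ⟨hclosed d hne, fun h => ?_⟩
      have := hclosed d.symm (by
        rintro rfl
        exact d.symm.snd_ne_fst (Finset.mem_filter.1 hd).2) h
      rwa [SimpleGraph.Dart.symm_symm] at this
    simp only [hiff]
    exact CharTwo.add_self_eq_zero _

section

variable {I : Set P.InnerFace} {e : G.Dart}

/-- A face outside a connected set of inner faces has at most one edge in common with it. -/
theorem DualConnected.dart_eq (hI : P.DualConnected I) (hG : G.IsTwoConnected)
    (hout : P.IsOuterplane) (he : P.faceOf e ≠ P.outerFace)
    (he' : P.faceOf e ∉ P.faceSet I) (heI : P.faceOf e.symm ∈ P.faceSet I) {d : G.Dart}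
    (hd : P.faceOf d = P.faceOf e) (hd' : P.faceOf d.symm ∈ P.faceSet I) : d = e := by
  obtain ⟨X, heX, hIX, hX⟩ := hI.exists_separation hout he he' heI
  by_contra hne
  refine hIX _ hd' ((hX d (hd ▸ he) hd'.1 hne ?_).1 (hd ▸ heX))
  rintro rfl
  exact P.faceOf_ne_faceOf_symm hG e hd.symm

/-- A face outside a connected set of inner faces which has an edge in common with it has no
further vertices in common with it. -/
theorem DualConnected.fst_eq (hI : P.DualConnected I) (hG : G.IsTwoConnected)
    (hout : P.IsOuterplane) (he : P.faceOf e ≠ P.outerFace)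
    (he' : P.faceOf e ∉ P.faceSet I) (heI : P.faceOf e.symm ∈ P.faceSet I) {d d' : G.Dart}
    (hd : P.faceOf d = P.faceOf e) (hd' : P.faceOf d' ∈ P.faceSet I) (hdd' : d.fst = d'.fst) :
    d.fst = e.fst ∨ d.fst = e.snd := by
  obtain ⟨X, heX, hIX, hX⟩ := hI.exists_separation hout he he' heI
  by_contra! hne
  obtain ⟨a, hav, hao⟩ := hout.exists_dart d.fst
  refine hIX _ hd' ((P.rot_between hav (hav.trans hdd') ?_ ?_ (fun d => P.faceOf d ∈ X) ?_).1
    (show P.faceOf d ∈ X from hd ▸ heX))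
  · rintro rfl
    exact he (hd.symm.trans hao)
  · rintro rfl
    exact hd'.1 hao
  · intro d₁ hv h1 h2
    rw [faceOf_rot]
    refine hX d₁ (fun h => h1 (P.dart_ext hG hv (h.trans hao.symm))) (fun h => ?_) ?_ ?_
    · rw [← faceOf_rot] at h
      exact h2 (P.dart_ext hG ((P.rot_fst _).trans hv) (h.trans hao.symm))
    · rintro rfl
      exact hne.1 (hv.trans hav).symm
    · rintro rfl
      exact hne.2 (hv.trans hav).symm

end

/-! ### Reducible face decompositions -/

variable (P) in
/-- The boundary of a face without one of its edges is a path; in a bipartite graph its length is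
odd. -/
theorem exists_ear (hG : G.IsTwoConnected) (c : G.Coloring Bool) (e : G.Dart) :
    ∃ p : G.Walk e.snd e.fst, p.IsPath ∧ Odd p.length ∧
      (∀ d, d ∈ p.darts ↔ P.faceOf d = P.faceOf e ∧ d ≠ e) ∧
      ∀ v, v ∈ p.support ↔ ∃ d : G.Dart, d.fst = v ∧ P.faceOf d = P.faceOf e := by
  have hper : 0 < Function.minimalPeriod P.next e :=
    Function.minimalPeriod_pos_of_mem_periodicPts
      (P.next.injective.mem_periodicPts e)
  obtain ⟨k, hk⟩ := Nat.exists_eq_add_one.2 hper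
  have hret : P.next^[k] (P.next e) = e := by
    have := Function.isPeriodicPt_minimalPeriod P.next e
    rw [hk] at this
    exact this
  obtain ⟨p, hp⟩ := exists_walk_next (P := P) k (P.next e) (P.next_fst e) (congrArg (·.fst) hret)
  have hface : ∀ n d, P.faceOf (P.next^[n] d) = P.faceOf d := by
    intro n
    induction n with
    | zero => intro d; rfl
    | succ n ih => intro d; rw [Function.iterate_succ_apply, ih, faceOf_next]
  have hdarts : ∀ d, d ∈ p.darts ↔ P.faceOf d = P.faceOf e ∧ d ≠ e := by
    intro d
    rw [hp, List.mem_iterate]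
    constructor
    · rintro ⟨m, hm, rfl⟩
      refine ⟨by rw [hface, faceOf_next], fun h => ?_⟩
      exact Function.not_isPeriodicPt_of_pos_of_lt_minimalPeriod (n := m + 1) (by omega)
        (by omega) h
    · rintro ⟨hf, hne⟩
      obtain ⟨n, hn⟩ := (P.faceOf_eq_iff.1 hf.symm).exists_nat_pow_eq
      rw [← Equiv.Perm.iterate_eq_pow, ← Function.iterate_mod_minimalPeriod_eq] at hn
      have hlt := Nat.mod_lt n hper
      obtain h0 | ⟨m, hm⟩ : n % Function.minimalPeriod P.next e = 0 ∨
          ∃ m, n % Function.minimalPeriod P.next e = m + 1 := by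
        cases n % Function.minimalPeriod P.next e <;> simp
      · rw [h0] at hn
        exact absurd hn.symm hne
      · rw [hm] at hn
        exact ⟨m, by omega, hn.symm⟩
  have hsupp : p.support = (p.darts ++ [e]).map (·.fst) := by
    rw [List.map_append, List.map_singleton, SimpleGraph.Walk.map_fst_darts_append]
  have hmem : ∀ d, d ∈ p.darts ++ [e] ↔ P.faceOf d = P.faceOf e := by
    intro d
    rw [List.mem_append, hdarts, List.mem_singleton]
    constructor
    · rintro (h | rfl)
      · exact h.1
      · rfl
    · intro h
      by_cases hd : d = e
      · exact Or.inr hd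
      · exact Or.inl ⟨h, hd⟩
  refine ⟨p, ?_, ?_, hdarts, fun v => ?_⟩
  · rw [SimpleGraph.Walk.isPath_def, hsupp]
    refine List.Nodup.map_on (fun d hd d' hd' h => ?_) (List.Nodup.append ?_ ?_ ?_)
    · exact P.dart_ext hG h (((hmem _).1 hd).trans ((hmem _).1 hd').symm)
    · rw [hp, ← List.range_map_iterate]
      refine List.Nodup.map_on (fun i hi j hj h => ?_) List.nodup_range
      rw [List.mem_range] at hi hj
      have := Function.iterate_injOn_Iio_minimalPeriod (f := P.next) (x := e)
        (show i + 1 < _ by omega) (show j + 1 < _ by omega) h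
      omega
    · exact List.nodup_singleton e
    · rw [List.disjoint_singleton]
      exact fun h => ((hdarts e).1 h).2 rfl
  · rw [c.odd_length_iff_not_congr]
    have := c.valid e.adj
    revert this
    cases c e.fst <;> cases c e.snd <;> simp
  · rw [hsupp, List.mem_map]
    simp only [hmem, and_comm]

/-- The inner faces can be listed in such a way that every face but the first one has a common
edge with an earlier one: by increasing distance from an arbitrary inner face. -/
theorem exists_face_sequence (hG : G.IsTwoConnected) :
    ∃ (m : ℕ) (s : Fin (m + 1) → P.InnerFace), Function.Bijective s ∧
      ∀ i : Fin m, ∃ j ≤ i.castSucc, P.innerDual.Adj (s i.succ) (s j) := by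
  obtain ⟨r⟩ := P.nonempty_innerFace hG
  obtain ⟨n, ⟨e⟩⟩ := Finite.exists_equiv_fin P.InnerFace
  obtain _ | m := n
  · exact (e r).elim0
  let f : Fin (m + 1) → ℕ := fun i => P.innerDual.dist r (e.symm i)
  let s : Fin (m + 1) → P.InnerFace := fun i => e.symm (Tuple.sort f i)
  have hmono : Monotone fun i => P.innerDual.dist r (s i) := Tuple.monotone_sort f
  have hs : Function.Bijective s := ((Tuple.sort f).trans e.symm).bijective
  have hconn := P.innerDual_preconnected hG
  have hroot : s 0 = r := by
    obtain ⟨i, hi⟩ := hs.2 r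
    have : P.innerDual.dist r (s 0) ≤ P.innerDual.dist r (s i) := hmono (Fin.zero_le i)
    rw [hi, SimpleGraph.dist_self, Nat.le_zero, (hconn _ _).dist_eq_zero_iff] at this
    exact this.symm
  refine ⟨m, s, hs, fun i => ?_⟩
  obtain ⟨p, hp⟩ := (hconn (s i.succ) r).exists_walk_length_eq_dist
  have hne : s i.succ ≠ r := fun h => Fin.succ_ne_zero i (hs.1 (h.trans hroot.symm))
  obtain ⟨t, h, q, rfl⟩ := p.exists_eq_cons_of_ne hne
  obtain ⟨j, rfl⟩ := hs.2 t
  refine ⟨j, ?_, h⟩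
  have hlt : P.innerDual.dist r (s j) < P.innerDual.dist r (s i.succ) := by
    rw [SimpleGraph.dist_comm, SimpleGraph.dist_comm (u := r), ← hp, SimpleGraph.Walk.length_cons]
    exact Nat.lt_succ_of_le (SimpleGraph.dist_le q)
  have hji : j < i.succ := by
    by_contra hle
    exact absurd (hmono (not_lt.1 hle)) (not_le.2 hlt)
  exact Fin.le_castSucc_iff.2 hji

/-- Every listing of the inner faces in which each face but the first one has a common edge with
an earlier one comes from a reducible face decomposition; the ears are the boundaries of the faces
without these edges. -/
theorem exists_reducibleFaceDecomposition (hG : G.IsTwoConnected) (hout : P.IsOuterplane)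
    (c₀ : G.Coloring Colour) {m : ℕ} (s : Fin (m + 1) → P.InnerFace) (hs : Function.Bijective s)
    (hadj : ∀ i : Fin m, ∃ j ≤ i.castSucc, P.innerDual.Adj (s i.succ) (s j)) :
    ∃ D : P.ReducibleFaceDecomposition m, D.face = s ∧
      ∀ (i : Fin m) (d : G.Dart), P.faceOf d = (s i.succ).1 →
        (∃ j ≤ i.castSucc, P.faceOf d.symm = (s j).1) →
          ∀ c : G.Coloring Colour, D.EarRuns c i (c d.snd) (c d.fst) := by
  let I : Fin (m + 1) → Set P.InnerFace := fun i => {t | ∃ j ≤ i, s j = t}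
  have hI : ∀ i, P.DualConnected (I i) := by
    intro i X hX
    have key : ∀ (n : ℕ) (k : Fin (m + 1)), k.val = n → k ≤ i → ((s k).1 ∈ X ↔ (s 0).1 ∈ X) := by
      intro n
      induction n using Nat.strong_induction_on with
      | _ n ih =>
        intro k hkn hki
        induction k using Fin.cases with
        | zero => rfl
        | succ k =>
          obtain ⟨j, hj, hjadj⟩ := hadj k
          obtain ⟨d, hd, hd'⟩ := (P.innerDual_adj_iff hG).1 hjadj
          have hjk : j < k.succ := Fin.le_castSucc_iff.1 hj
          have h := hX d (hd ▸ mem_faceSet.2 ⟨_, hki, rfl⟩)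
            (hd' ▸ mem_faceSet.2 ⟨j, hjk.le.trans hki, rfl⟩)
          rw [hd, hd'] at h
          rw [h]
          exact ih j.val (hkn ▸ hjk) j rfl (hjk.le.trans hki)
    rintro _ ⟨k, hk, rfl⟩ _ ⟨k', hk', rfl⟩
    rw [key _ k rfl hk, key _ k' rfl hk']
  have hnot : ∀ i : Fin m, (s i.succ).1 ∉ P.faceSet (I i.castSucc) := by
    intro i h
    obtain ⟨j, hj, hj'⟩ := mem_faceSet.1 h
    rw [hs.1 hj'] at hj
    exact absurd hj (not_le.2 i.castSucc_lt_succ)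
  have hsucc : ∀ (i : Fin m) (f : P.Face), f ∈ P.faceSet (I i.succ) ↔
      f ∈ P.faceSet (I i.castSucc) ∨ f = (s i.succ).1 := by
    intro i f
    constructor
    · rintro ⟨hf, j, hj, hj'⟩
      rcases hj.lt_or_eq with h | rfl
      · exact Or.inl ⟨hf, j, Fin.le_castSucc_iff.2 h, hj'⟩
      · exact Or.inr (congrArg Subtype.val hj').symm
    · rintro (⟨hf, j, hj, hj'⟩ | rfl)
      · exact ⟨hf, j, hj.trans i.castSucc_lt_succ.le, hj'⟩
      · exact mem_faceSet.2 ⟨_, le_rfl, rfl⟩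
  have hdart : ∀ i : Fin m, ∃ e : G.Dart, P.faceOf e = (s i.succ).1 ∧
      P.faceOf e.symm ∈ P.faceSet (I i.castSucc) := by
    intro i
    obtain ⟨j, hj, hjadj⟩ := hadj i
    obtain ⟨d, hd, hd'⟩ := (P.innerDual_adj_iff hG).1 hjadj
    exact ⟨d, hd, hd' ▸ mem_faceSet.2 ⟨j, hj, rfl⟩⟩
  choose e hes heI using hdart
  have heo : ∀ i, P.faceOf (e i) ≠ P.outerFace := fun i => by
    rw [hes]
    exact (s i.succ).2
  have hen : ∀ i, P.faceOf (e i) ∉ P.faceSet (I i.castSucc) := fun i => by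
    rw [hes]
    exact hnot i
  choose p hpath hodd hdarts hsupp using fun i => P.exists_ear hG c₀ (e i)
  have hother : ∀ i, ∀ d ∈ (p i).darts, P.faceOf d.symm ∉ P.faceSet (I i.castSucc) := by
    intro i d hd h
    obtain ⟨h1, h2⟩ := (hdarts i d).1 hd
    exact h2 ((hI _).dart_eq hG hout (heo i) (hen i) (heI i) h1 h)
  have hear : ∀ i, ∀ d ∈ (p i).darts, P.faceOf d ∉ P.faceSet (I i.castSucc) := by
    intro i d hd
    rw [((hdarts i d).1 hd).1]
    exact hen i
  have hclock : ∀ i, P.IsClockwise (P.region (I i.succ)) (p i) := by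
    intro i d hd
    have hd1 := ((hdarts i d).1 hd).1
    have hdI : P.faceOf d ∈ P.faceSet (I i.succ) := (hsucc _ _).2 (Or.inr (hd1.trans (hes i)))
    refine ⟨edge_mem_region.2 (Or.inl hdI), ?_, fun h => notMem_faceSet_of_inExterior h hdI⟩
    rw [inExterior_region_iff (hI _) hout, hsucc, not_or]
    refine ⟨hother i d hd, fun h => ?_⟩
    rw [← hes, ← hd1] at h
    exact P.faceOf_ne_faceOf_symm hG d h.symm
  have hstart : ∀ i, (e i).snd ∈ (P.region (I i.castSucc)).verts := fun i =>
    ⟨(e i).symm, rfl, heI i⟩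
  have hfinish : ∀ i, (e i).fst ∈ (P.region (I i.castSucc)).verts := fun i =>
    ⟨P.next (e i).symm, P.next_fst _, by rw [faceOf_next]; exact heI i⟩
  refine ⟨{ graph := fun i => P.region (I i)
            face := s
            start := fun i => (e i).snd
            finish := fun i => (e i).fst
            ear := p
            face_bijective := hs
            graph_zero := ?_
            graph_last := ?_
            ear_isPath := hpath
            ear_odd := hodd
            start_mem := hstart
            finish_mem := hfinish
            ends_colour := ?_
            ear_internal := ?_
            graph_succ := ?_
            ear_exterior := ?_
            ear_surround := ?_ }, rfl, ?_⟩
  · have : I 0 = {s 0} := by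
      ext t
      constructor
      · rintro ⟨j, hj, rfl⟩
        rw [Fin.le_zero_iff.1 hj]
        rfl
      · rintro rfl
        exact ⟨0, le_rfl, rfl⟩
    rw [this, region_singleton]
  · have hall : ∀ f, f ≠ P.outerFace → f ∈ P.faceSet (I (Fin.last m)) := by
      intro f hf
      obtain ⟨j, hj⟩ := hs.2 ⟨f, hf⟩
      exact ⟨hf, j, Fin.le_last j, hj⟩
    have hedge : ∀ d : G.Dart, d.edge ∈ (P.region (I (Fin.last m))).edgeSet := by
      intro d
      rw [edge_mem_region]
      by_cases h : P.faceOf d = P.outerFace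
      · exact Or.inr (hall _ fun h' => P.faceOf_ne_faceOf_symm hG d (h.trans h'.symm))
      · exact Or.inl (hall _ h)
    refine SimpleGraph.Subgraph.ext ?_ ?_
    · refine Set.eq_univ_of_forall fun v => ?_
      obtain ⟨d, rfl, -⟩ := hout.exists_dart v
      exact (P.region _).edge_vert (hedge d)
    · ext u v
      exact ⟨fun h => h.adj_sub, fun h => hedge ⟨(u, v), h⟩⟩
  · intro i c
    exact c.valid (show (P.region (I i.castSucc)).Adj (e i).snd (e i).fst from
      ⟨(e i).symm, rfl, heI i⟩)
  · rintro i v hv ⟨d', rfl, hd'⟩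
    obtain ⟨d, hd, hdf⟩ := (hsupp i _).1 hv
    have := (hI _).fst_eq hG hout (heo i) (hen i) (heI i) hdf hd' hd
    rw [hd] at this
    exact this.symm
  · intro i
    refine SimpleGraph.Subgraph.ext ?_ ?_
    · ext v
      rw [SimpleGraph.Subgraph.verts_sup, Set.mem_union, SimpleGraph.Walk.mem_verts_toSubgraph,
        hsupp, hes]
      constructor
      · rintro ⟨d, hd, h⟩
        rcases (hsucc _ _).1 h with h | h
        · exact Or.inl ⟨d, hd, h⟩
        · exact Or.inr ⟨d, hd, h⟩
      · rintro (⟨d, hd, h⟩ | ⟨d, hd, h⟩)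
        · exact ⟨d, hd, (hsucc _ _).2 (Or.inl h)⟩
        · exact ⟨d, hd, (hsucc _ _).2 (Or.inr h)⟩
    · ext u v
      rw [SimpleGraph.Subgraph.sup_adj, SimpleGraph.Walk.adj_toSubgraph_iff_mem_edges]
      constructor
      · rintro ⟨d, hd, h⟩
        rcases (hsucc _ _).1 h with h | h
        · exact Or.inl ⟨d, hd, h⟩
        · by_cases hde : d = e i
          · subst hde
            exact Or.inl ⟨(e i).symm, by rw [SimpleGraph.Dart.edge_symm, hd], heI i⟩
          · right
            rw [← hd]
            exact List.mem_map_of_mem ((hdarts i d).2 ⟨h.trans (hes i).symm, hde⟩)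
      · rintro (⟨d, hd, h⟩ | h)
        · exact ⟨d, hd, (hsucc _ _).2 (Or.inl h)⟩
        · obtain ⟨d, hd, hd'⟩ := List.mem_map.1 h
          exact ⟨d, hd', (hsucc _ _).2 (Or.inr (((hdarts i d).1 hd).1.trans (hes i)))⟩
  · intro i e' he'
    obtain ⟨d, hd, rfl⟩ := List.mem_map.1 he'
    refine ⟨fun h => (edge_mem_region.1 h).elim (hear i d hd) (hother i d hd), fun d' hd' => ?_⟩
    rw [inExterior_region_iff (hI _) hout]
    rcases (SimpleGraph.dart_edge_eq_iff _ _).1 hd' with rfl | rfl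
    · exact hear i d' hd
    · exact hother i d hd
  · intro i
    refine ⟨{(e i).edge}, ?_, ?_⟩
    · rintro _ rfl
      refine ⟨edge_mem_region.2 (Or.inr (heI i)), e i, rfl, ?_⟩
      rw [inExterior_region_iff (hI _) hout]
      exact hen i
    · ext e'
      constructor
      · rintro ⟨d, hd, rfl⟩
        by_cases hde : d = e i
        · exact Or.inr (congrArg _ hde)
        · exact Or.inl (List.mem_map_of_mem ((hdarts i d).2 ⟨hd.trans (hes i).symm, hde⟩))
      · rintro (h | rfl)
        · obtain ⟨d, hd, rfl⟩ := List.mem_map.1 h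
          exact ⟨d, ((hdarts i d).1 hd).1.trans (hes i), rfl⟩
        · exact ⟨e i, hes i, rfl⟩
  -- the ear follows the new face clockwise, from the head of the omitted dart to its tail
  · rintro i d hd ⟨j, hj, hd'⟩ c
    have hde : d = e i := (hI _).dart_eq hG hout (heo i) (hen i) (heI i) (hd.trans (hes i).symm)
      (hd' ▸ mem_faceSet.2 ⟨j, hj, rfl⟩)
    subst hde
    exact Or.inl ⟨hclock i, rfl, rfl⟩

end

end PlaneEmbedding

/-! ### Isomorphisms of resonance graphs -/

namespace PlaneEmbedding

variable {V : Type*} [Fintype V] {G : SimpleGraph V} (P : PlaneEmbedding G)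

theorem innerDual_adj_iff_dualArc (hG : G.IsTwoConnected) (c : G.Coloring Colour)
    {s t : P.InnerFace} : P.innerDual.Adj s t ↔ P.DualArc c s t ∨ P.DualArc c t s := by
  rw [P.innerDual_adj_iff hG]
  constructor
  · rintro ⟨d, hs, ht⟩
    rcases white_or_symm_white c d with h | h
    · exact Or.inl ⟨d, h, hs, ht⟩
    · exact Or.inr ⟨d.symm, h, ht, by rwa [SimpleGraph.Dart.symm_symm]⟩
  · rintro (⟨d, -, hs, ht⟩ | ⟨d, -, ht, hs⟩)
    · exact ⟨d, hs, ht⟩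
    · exact ⟨d.symm, hs, by rwa [SimpleGraph.Dart.symm_symm]⟩

theorem hasLabel_unique (hG : G.IsTwoConnected) (hout : P.IsOuterplane) (c : G.Coloring Colour)
    {M N : G.PerfectMatching} {s t : P.InnerFace} (hs : P.HasLabel M N s) (ht : P.HasLabel M N t) :
    s = t := by
  obtain ⟨Φ, hΦ⟩ := P.exists_encoding hG hout c
  rw [hasLabel_iff (Φ M).2 (hΦ M) (Φ N).2 (hΦ N) hG] at hs ht
  exact Set.singleton_injective (hs.symm.trans ht)

/-- Every inner face is the label of an edge of the resonance graph. -/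
theorem exists_hasLabel (hG : G.IsTwoConnected) (hout : P.IsOuterplane) (c : G.Coloring Colour)
    (s : P.InnerFace) : ∃ M N : G.PerfectMatching, P.HasLabel M N s := by
  obtain ⟨Φ, hΦ⟩ := P.exists_encoding hG hout c
  obtain ⟨S, T, h⟩ := (P.isOrientedTree hG hout c).exists_symmDiff_eq s
  refine ⟨Φ.symm S, Φ.symm T, ?_⟩
  rw [hasLabel_iff (Φ _).2 (hΦ _) (Φ _).2 (hΦ _) hG, Equiv.apply_symm_apply,
    Equiv.apply_symm_apply]
  exact h

/-- For a suitable colouring of the second graph, an isomorphism of resonance graphs is induced by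
an isomorphism of the oriented inner duals. -/
theorem exists_dual_equiv {V' : Type*} [Fintype V'] {G' : SimpleGraph V'} {P : PlaneEmbedding G}
    {P' : PlaneEmbedding G'} (hG : G.IsTwoConnected) (hG' : G'.IsTwoConnected)
    (hout : P.IsOuterplane) (hout' : P'.IsOuterplane) (c : G.Coloring Colour)
    (c₀ : G'.Coloring Colour) (φ : P.resonanceGraph ≃g P'.resonanceGraph) :
    ∃ (ψ : P.InnerFace ≃ P'.InnerFace) (c' : G'.Coloring Colour),
      (∀ M N s, P.HasLabel M N s → P'.HasLabel (φ M) (φ N) (ψ s)) ∧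
      (∀ a b, P'.DualArc c' (ψ a) (ψ b) ↔ P.DualArc c a b) ∧
      ∀ M N s, P.HasLabel M N s → (P'.IsProper c' (φ M) (ψ s) ↔ P.IsProper c M s) := by
  obtain ⟨Φ, hΦ⟩ := P.exists_encoding hG hout c
  obtain ⟨Φ', hΦ'⟩ := P'.exists_encoding hG' hout' c₀
  have hlabel : ∀ M N s, P.HasLabel M N s ↔ symmDiff (Φ M).1 (Φ N).1 = {s} := fun M N s =>
    hasLabel_iff (Φ M).2 (hΦ M) (Φ N).2 (hΦ N) hG s
  have hlabel' : ∀ M N s, P'.HasLabel M N s ↔ symmDiff (Φ' M).1 (Φ' N).1 = {s} := fun M N s =>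
    hasLabel_iff (Φ' M).2 (hΦ' M) (Φ' N).2 (hΦ' N) hG' s
  obtain ⟨ψ, hψ, hcase⟩ := (P.isOrientedTree hG hout c).exists_equiv_of_closedSetIso
    ((Φ.symm.trans φ.toEquiv).trans Φ') (P'.isOrientedTree hG' hout' c₀) fun S T => by
      obtain ⟨M, rfl⟩ := Φ.surjective S
      obtain ⟨N, rfl⟩ := Φ.surjective T
      simp only [Equiv.trans_apply, Equiv.symm_apply_apply, ← hlabel, ← hlabel']
      exact (φ.map_rel_iff (a := M) (b := N)).symm
  have hψ' : ∀ M N s, P.HasLabel M N s → P'.HasLabel (φ M) (φ N) (ψ s) := by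
    intro M N s h
    rw [hlabel] at h
    have := hψ _ _ _ h
    simp only [Equiv.trans_apply, Equiv.symm_apply_apply] at this
    exact (hlabel' _ _ _).2 this
  rcases hcase with ⟨harc, hmem⟩ | ⟨harc, hmem⟩
  · refine ⟨ψ, c₀, hψ', harc, fun M N s h => ?_⟩
    rw [isProper_iff (Φ M).2 (hΦ M) (Φ N).2 (hΦ N) hG h,
      isProper_iff (Φ' _).2 (hΦ' _) (Φ' _).2 (hΦ' _) hG' (hψ' _ _ _ h)]
    have := hmem (Φ M) s
    simp only [Equiv.trans_apply, Equiv.symm_apply_apply] at this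
    exact this
  · refine ⟨ψ, swapColour c₀, hψ', fun a b => dualArc_swapColour.trans (harc b a),
      fun M N s h => ?_⟩
    rw [isProper_iff (Φ M).2 (hΦ M) (Φ N).2 (hΦ N) hG h,
      isProper_iff (arcClosed_swapColour (Φ' _).2) (hΦ' _).swapColour
        (arcClosed_swapColour (Φ' _).2) (hΦ' _).swapColour hG' (hψ' _ _ _ h)]
    have := hmem (Φ M) s
    simp only [Equiv.trans_apply, Equiv.symm_apply_apply] at this
    rw [Set.mem_compl_iff]
    exact (not_congr this).trans not_not

end PlaneEmbedding

theorem theorem3p2 {V V' : Type*} [Finite V] [Finite V']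
    {G : SimpleGraph V} {G' : SimpleGraph V'}
    (P : PlaneEmbedding G) (P' : PlaneEmbedding G')
    (hconn : G.IsTwoConnected) (hconn' : G'.IsTwoConnected)
    (hbip : G.IsBipartite) (hbip' : G'.IsBipartite)
    (hout : P.IsOuterplane) (hout' : P'.IsOuterplane)
    (φ : P.resonanceGraph ≃g P'.resonanceGraph) :
    ∃ φhat : P.innerDual ≃g P'.innerDual,
      PlaneEmbedding.IsInducedBy φ φhat ∧
      (∀ ψ : P.innerDual ≃g P'.innerDual, PlaneEmbedding.IsInducedBy φ ψ → ψ = φhat) ∧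
      ∃ (m : ℕ) (D : P.ReducibleFaceDecomposition m) (D' : P'.ReducibleFaceDecomposition m),
        (∀ i : Fin (m + 1), φhat (D.face i) = D'.face i) ∧
        ∃ (c : G.Coloring Colour) (c' : G'.Coloring Colour),
          (∀ i : Fin m,
            (D.EarRuns c i Colour.black Colour.white ∧
              D'.EarRuns c' i Colour.black Colour.white) ∨
            (D.EarRuns c i Colour.white Colour.black ∧
              D'.EarRuns c' i Colour.white Colour.black)) ∧
          ∀ M N : G.PerfectMatching,
            (P.resonanceDigraph c).Adj M N ↔ (P'.resonanceDigraph c').Adj (φ M) (φ N) := by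
  have : Fintype V := Fintype.ofFinite V
  have : Fintype V' := Fintype.ofFinite V'
  obtain ⟨c₁⟩ := hbip
  obtain ⟨c₁'⟩ := hbip'
  let c : G.Coloring Colour := G.recolorOfEquiv finTwoEquiv c₁
  obtain ⟨ψ, c', hlabel, harc, hproper⟩ := PlaneEmbedding.exists_dual_equiv hconn hconn' hout hout'
    c (G'.recolorOfEquiv finTwoEquiv c₁') φ
  let φhat : P.innerDual ≃g P'.innerDual :=
    { toEquiv := ψ
      map_rel_iff' := fun {s t} => by
        rw [P.innerDual_adj_iff_dualArc hconn c, P'.innerDual_adj_iff_dualArc hconn' c', harc,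
          harc] }
  refine ⟨φhat, hlabel, fun χ hχ => ?_, ?_⟩
  · ext s
    obtain ⟨M, N, h⟩ := P.exists_hasLabel hconn hout c s
    exact P'.hasLabel_unique hconn' hout' c' (hχ M N s h) (hlabel M N s h)
  obtain ⟨m, s, hs, hadj⟩ := PlaneEmbedding.exists_face_sequence (P := P) hconn
  obtain ⟨D, rfl, hD⟩ :=
    PlaneEmbedding.exists_reducibleFaceDecomposition hconn hout c s hs hadj
  obtain ⟨D', hDD', hD'⟩ := PlaneEmbedding.exists_reducibleFaceDecomposition hconn' hout' c'
    (fun i => φhat (D.face i)) (φhat.bijective.comp hs) fun i => by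
      obtain ⟨j, hj, h⟩ := hadj i
      exact ⟨j, hj, φhat.map_rel_iff.2 h⟩
  refine ⟨m, D, D', fun i => (congrFun hDD' i).symm, c, c', fun i => ?_, fun M N => ?_⟩
  · obtain ⟨j, hj, h⟩ := hadj i
    -- the chord between the new face and the earlier one has the same direction in both graphs
    rcases (P.innerDual_adj_iff_dualArc hconn c).1 h with h | h
    · obtain ⟨d, hd, h1, h2⟩ := id h
      obtain ⟨d', hd', h1', h2'⟩ := (harc _ _).2 h
      have hr := hD i d h1 ⟨j, hj, h2⟩ c
      have hr' := hD' i d' h1' ⟨j, hj, h2'⟩ c'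
      rw [PlaneEmbedding.colour_snd, hd] at hr
      rw [PlaneEmbedding.colour_snd, hd'] at hr'
      exact Or.inl ⟨hr, hr'⟩
    · obtain ⟨d, hd, h1, h2⟩ := id h
      obtain ⟨d', hd', h1', h2'⟩ := (harc _ _).2 h
      have hr := hD i d.symm h2 ⟨j, hj, by rwa [SimpleGraph.Dart.symm_symm]⟩ c
      have hr' := hD' i d'.symm h2' ⟨j, hj, by rwa [SimpleGraph.Dart.symm_symm]⟩ c'
      have hs : c d.symm.fst = _ := PlaneEmbedding.colour_snd c d
      have hs' : c' d'.symm.fst = _ := PlaneEmbedding.colour_snd c' d'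
      rw [PlaneEmbedding.colour_snd, hs, hd] at hr
      rw [PlaneEmbedding.colour_snd, hs', hd'] at hr'
      exact Or.inr ⟨hr, hr'⟩
  · constructor
    · rintro ⟨t, ht, hp⟩
      exact ⟨ψ t, hlabel M N t ht, (hproper M N t ht).2 hp⟩
    · rintro ⟨t', ht', hp'⟩
      obtain ⟨t, ht⟩ := φ.map_rel_iff.1 (show P'.resonanceGraph.Adj (φ M) (φ N) from ⟨t', ht'⟩)
      obtain rfl := P'.hasLabel_unique hconn' hout' c' ht' (hlabel M N t ht)
      exact ⟨t, ht, (hproper M N t ht).1 hp'⟩
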